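/- Throughout, a finite set $P\subset\mathbb{R}^d$ is called separated if $\|p-q\|\ge 1$ for all distinct $p,q\in P$. For $k\ge 1$ and $\varepsilon>0$, a separated set $P$ is an $\varepsilon$-nearly $k$-distance set if there are reals $1<t_1<\dots<t_k$ such that $\|p-q\|\in\bigcup_{i=1}^k[t_i,t_i+\varepsilon]$ for all distinct $p,q\in P$. For $d\ge 2$ and $\alpha>0$, $P\subset\mathbb{R}^d$ is almost $(d-1,\alpha)$-flat if for all but at most two points $p\in P$ there is a hyperplane $\Lambda_p$ such that for every $q\in P\setminus\{p\}$ the angle between the vector $p-q$ and $\Lambda_p$ (the infimum of the angles between $p-q$ and the nonzero vectors parallel to $\Lambda_p$) is at most $\alpha$. Let $A_k(d)$ be the largest $N$ such that for all $\varepsilon,\alpha>0$ there exists an almost $(d-1,\alpha)$-flat $\varepsilon$-nearly $k$-distance set of cardinality $N$ in $\mathbb{R}^d$. For $w>0$ let $M_k(d,n;w)$ be the largest $M$ for which there are a separated set $S\subset\mathbb{R}^d$ of $n$ points and reals $1\le t_1\le\dots\le t_k$ such that at least $M$ unordered pairs of distinct points $p,q\in S$ satisfy $\|p-q\|\in\bigcup_{i=1}^k[t_i,t_i+w]$,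 and put $M_k(d,n)=M_k(d,n;1)$. Let $T(n,s)$ be the number of edges of the balanced complete $s$-partite graph on $n$ vertices. Theorem. Let $d\ge 2$ and $k\ge 1$. Then the maximum $A_k(d)$ exists, and there is $n_0$ such that for all $n\ge n_0$ $$M_k(d,n)\le T(n,A_k(d))\le\left(1-\frac1{A_k(d)}\right)\frac{n^2}{2}.$$ Moreover, there are a constant $c=c(k,d)>0$ and $n_0$ such that for all $n\ge n_0$ $$M_k\bigl(d,n;\,c\,n^{1/d}\bigr)\le T(n,A_k(d))\le\left(1-\frac1{A_k(d)}\right)\frac{n^2}{2}.$$ -/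

import Mathlib

namespace NearDist

/-- A finite set of points is separated if distinct points are at distance at least `1`. -/
def IsSeparated {d : ℕ} (P : Finset (EuclideanSpace ℝ (Fin d))) : Prop :=
  ∀ p ∈ P, ∀ q ∈ P, p ≠ q → 1 ≤ dist p q

/-- `P` is an `ε`-nearly `k`-distance set: it is separated and there are `1 < t₁ < ⋯ < tₖ` such that
every distance between distinct points of `P` lies in some `[tᵢ, tᵢ + ε]`. -/
def IsNearlyDistanceSet {d : ℕ} (k : ℕ) (ε : ℝ) (P : Finset (EuclideanSpace ℝ (Fin d))) : Prop :=
  IsSeparated P ∧ ∃ t : Fin k → ℝ, (∀ i, 1 < t i) ∧ StrictMono t ∧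
    ∀ p ∈ P, ∀ q ∈ P, p ≠ q → ∃ i, dist p q ∈ Set.Icc (t i) (t i + ε)

/-- The angle between a vector `v` and a plane (affine subspace) `Λ`: the infimum of the angles
between `v` and the nonzero vectors of `Λ - Λ`. -/
noncomputable def angleToPlane {d : ℕ} (v : EuclideanSpace ℝ (Fin d))
    (Λ : AffineSubspace ℝ (EuclideanSpace ℝ (Fin d))) : ℝ :=
  ⨅ w : {w : EuclideanSpace ℝ (Fin d) // w ∈ Λ.direction ∧ w ≠ 0},
    InnerProductGeometry.angle v (w : EuclideanSpace ℝ (Fin d))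

/-- `Λ` is a plane of dimension `j`. -/
def IsPlaneOfDim {d : ℕ} (j : ℕ) (Λ : AffineSubspace ℝ (EuclideanSpace ℝ (Fin d))) : Prop :=
  (Λ : Set (EuclideanSpace ℝ (Fin d))).Nonempty ∧ Module.finrank ℝ Λ.direction = j

/-- `P` is `(p, j, α)`-flat. For `j ≥ 1`: there is a `j`-plane `Λ` such that the angle between
`p - q` and `Λ` is at most `α` for all `q ∈ P`, `q ≠ p`. For `j = 0`: `P` has at most one point. -/
def IsFlatAt {d : ℕ} (P : Finset (EuclideanSpace ℝ (Fin d))) (p : EuclideanSpace ℝ (Fin d))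
    (j : ℕ) (α : ℝ) : Prop :=
  (j = 0 ∧ P.card ≤ 1) ∨
  (1 ≤ j ∧ ∃ Λ : AffineSubspace ℝ (EuclideanSpace ℝ (Fin d)), IsPlaneOfDim j Λ ∧
    ∀ q ∈ P, q ≠ p → angleToPlane (p - q) Λ ≤ α)

/-- `P` is almost `(j, α)`-flat: it is `(p, j, α)`-flat for all but at most two `p ∈ P`. -/
def IsAlmostFlat {d : ℕ} (P : Finset (EuclideanSpace ℝ (Fin d))) (j : ℕ) (α : ℝ) : Prop :=
  ∃ E : Finset (EuclideanSpace ℝ (Fin d)), E.card ≤ 2 ∧ ∀ p ∈ P, p ∉ E → IsFlatAt P p j α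

/-- The cardinalities `N` such that for all `ε, α > 0` there is an almost `(j, α)`-flat
`ε`-nearly `k`-distance set of cardinality `N` in `ℝ^d`. -/
def almostFlatCards (k d j : ℕ) : Set ℕ :=
  {N | ∀ ε : ℝ, 0 < ε → ∀ α : ℝ, 0 < α → ∃ P : Finset (EuclideanSpace ℝ (Fin d)),
    P.card = N ∧ IsNearlyDistanceSet k ε P ∧ IsAlmostFlat P j α}

/-- `A_k(d, j)`, the largest element of `almostFlatCards k d j`. -/
noncomputable def almostFlatMax (k d j : ℕ) : ℕ := sSup (almostFlatCards k d j)

/-- `A_k(d) = A_k(d, d - 1)` (used for `d ≥ 1`). -/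
noncomputable def A (k d : ℕ) : ℕ := almostFlatMax k d (d - 1)

/-- The graph on `S` joining distinct points whose distance lies in some `[tᵢ, tᵢ + w]`. -/
def nearGraph {d k : ℕ} (S : Finset (EuclideanSpace ℝ (Fin d))) (t : Fin k → ℝ) (w : ℝ) :
    SimpleGraph S where
  Adj p q := p ≠ q ∧ ∃ i, dist (p : EuclideanSpace ℝ (Fin d)) q ∈ Set.Icc (t i) (t i + w)
  symm := ⟨fun p q h => ⟨h.1.symm, by simpa only [dist_comm] using h.2⟩⟩
  loopless := ⟨fun _ h => h.1 rfl⟩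

/-- The numbers `M` such that there are a separated set `S` of `n` points in `ℝ^d` and reals
`1 ≤ t₁ ≤ ⋯ ≤ tₖ` for which at least `M` (unordered) pairs of points of `S` have their distance in
`⋃ᵢ [tᵢ, tᵢ + w]`. -/
def nearPairCounts (k d n : ℕ) (w : ℝ) : Set ℕ :=
  {M | ∃ S : Finset (EuclideanSpace ℝ (Fin d)), S.card = n ∧ IsSeparated S ∧
    ∃ t : Fin k → ℝ, (∀ i, 1 ≤ t i) ∧ Monotone t ∧ M ≤ (nearGraph S t w).edgeSet.ncard}

/-- `M_k(d, n)` with intervals `[tᵢ, tᵢ + w]`; the quantity `M_k(d, n)` itself is the case `w = 1`.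
It is a maximum, see `isGreatest_nearPairMax`. -/
noncomputable def nearPairMax (k d n : ℕ) (w : ℝ) : ℕ := sSup (nearPairCounts k d n w)

/-- `T(n, s)`, the number of edges of the balanced complete `s`-partite graph on `n` vertices
(`s ≥ 1`). -/
def turanNumber (n s : ℕ) : ℕ := (SimpleGraph.turanGraph n s).edgeFinset.card

theorem isGreatest_nearPairMax (k d n : ℕ) (hd : 1 ≤ d) (w : ℝ) :
    IsGreatest (nearPairCounts k d n w) (nearPairMax k d n w) := by
  have hb : BddAbove (nearPairCounts k d n w) := by
    refine ⟨n.choose 2, ?_⟩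
    rintro M ⟨S, hS, -, t, -, -, hM⟩
    classical
    refine hM.trans ?_
    have := (nearGraph S t w).card_edgeFinset_le_card_choose_two
    rw [← SimpleGraph.coe_edgeFinset, Set.ncard_coe_finset]
    simpa [hS] using this
  have hne : (nearPairCounts k d n w).Nonempty := by
    let f : ℕ → EuclideanSpace ℝ (Fin d) := fun m => EuclideanSpace.single ⟨0, hd⟩ (m : ℝ)
    have hf : ∀ a b : ℕ, dist (f a) (f b) = dist a b := by
      intro a b
      simp [f, Nat.dist_cast_real]
    have hinj : Function.Injective f := by
      intro a b hab
      have := hf a b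
      rw [hab, dist_self] at this
      exact dist_eq_zero.mp this.symm
    refine ⟨0, (Finset.range n).map ⟨f, hinj⟩, by simp, ?_, fun _ => 1, fun _ => le_rfl,
      fun _ _ _ => le_rfl, Nat.zero_le _⟩
    intro p hp q hq hpq
    simp only [Finset.mem_map, Function.Embedding.coeFn_mk] at hp hq
    obtain ⟨a, -, rfl⟩ := hp
    obtain ⟨b, -, rfl⟩ := hq
    rw [hf]
    exact Nat.pairwise_one_le_dist (fun h => hpq (by rw [h]))
  exact ⟨Nat.sSup_mem hne hb, fun M hM => le_csSup hb hM⟩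

end NearDist

/-! Write `s = A k d`. The maximum exists because a nearly `k`-distance set has boundedly many
points (`card_le_of_dist_mem`). For the upper bound, suppose a separated set has more than `T(n,s)`
pairs in the `k` annuli of width `w = κD`, where `D` is a small multiple of `n^(1/d)`. The goal is
an almost flat nearly `k`-distance set with `s + 1` points, for `ε` and `α` at which none exists.

The combinatorial half (`exists_isBlowup_of_lt_dartCount`) enlarges `s - 1` vertices of a
`(s+1)`-clique to classes of bounded but arbitrarily large size, all joins to them being of one
colour (one annulus). Only two vertices stay single, since a vertex of nearly minimal degree can
miss up to two of them at the last stage. A conflict graph joins points at distance below `2D`. By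
volume its degrees are at most a small multiple of `n`, so conflicts involving the classes can be
avoided; this is where the order `n^(1/d)` comes from.

The geometric half (`exists_isAlmostFlat`) finds in each large class two points that are relatively
close to each other. Both have nearly the same distance to any point of another class, so their
difference is a normal vector of a nearly containing hyperplane. The two single points are the two
exceptions allowed by almost flatness.

The two single vertices may still be close to each other. Then their annulus is useless for long
distances, so its parameter is free. It is reassigned to the distance of another, well separated
pair joined to all the classes (`exists_almostFlat_of_isBlowup`). -/

namespace NearDist

open Finset

/-! ### Degrees, Turán numbers and large minimum degree -/

section Graph

variable {V : Type*}

open scoped Classical in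
/-- The number of neighbours of `v` in `U`. -/
noncomputable def degIn (G : SimpleGraph V) (U : Finset V) (v : V) : ℕ :=
  #{u ∈ U | G.Adj v u}

/-- Twice the number of edges of `G` inside `U`. -/
noncomputable def dartCount (G : SimpleGraph V) (U : Finset V) : ℕ :=
  ∑ v ∈ U, degIn G U v

theorem degIn_le_card (G : SimpleGraph V) (U : Finset V) (v : V) : degIn G U v ≤ #U := by
  classical exact card_filter_le _ _

theorem degIn_mono {G G' : SimpleGraph V} (h : G ≤ G') {U U' : Finset V} (hU : U ⊆ U') (v : V) :
    degIn G U v ≤ degIn G' U' v := by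
  classical
  refine card_le_card fun x hx => ?_
  rw [mem_filter] at hx ⊢
  exact ⟨hU hx.1, h hx.2⟩

theorem dartCount_le_sq (G : SimpleGraph V) (U : Finset V) : dartCount G U ≤ #U ^ 2 := by
  refine (sum_le_sum fun v _ => degIn_le_card G U v).trans ?_
  simp [sq]

theorem dartCount_erase [DecidableEq V] (G : SimpleGraph V) {U : Finset V} {v : V} (hv : v ∈ U) :
    dartCount G U = dartCount G (U.erase v) + 2 * degIn G U v := by
  classical
  have h1 : ∀ x ∈ U.erase v, degIn G U x = degIn G (U.erase v) x + if G.Adj v x then 1 else 0 := by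
    intro x hx
    unfold degIn
    conv_lhs => rw [← insert_erase hv, filter_insert]
    by_cases h : G.Adj v x
    · rw [if_pos h.symm, if_pos h, card_insert_of_notMem (by simp)]
    · rw [if_neg (fun h' => h h'.symm), if_neg h, add_zero]
  have h2 : ∑ x ∈ U.erase v, (if G.Adj v x then 1 else 0) = degIn G U v := by
    rw [← card_filter]
    unfold degIn
    congr 1
    ext x
    simp only [mem_filter, mem_erase]
    exact ⟨fun h => ⟨h.1.2, h.2⟩, fun h => ⟨⟨h.2.ne', h.1⟩, h.2⟩⟩
  rw [dartCount, ← add_sum_erase _ _ hv, sum_congr rfl h1, sum_add_distrib, h2, dartCount]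
  ring

theorem two_mul_ncard_edgeSet_comap (G : SimpleGraph V) (U : Finset V) :
    2 * (G.comap (Subtype.val : U → V)).edgeSet.ncard = dartCount G U := by
  classical
  rw [← SimpleGraph.coe_edgeFinset, Set.ncard_coe_finset,
    ← SimpleGraph.sum_degrees_eq_twice_card_edges, dartCount, ← sum_coe_sort U]
  refine sum_congr rfl fun v _ => ?_
  rw [← SimpleGraph.card_neighborFinset_eq_degree, degIn]
  refine card_bij (fun x _ => (x : V)) ?_ ?_ ?_
  · intro a ha
    rw [SimpleGraph.mem_neighborFinset] at ha
    exact mem_filter.2 ⟨a.2, ha⟩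
  · intro a _ b _ h
    exact Subtype.ext h
  · intro b hb
    rw [mem_filter] at hb
    exact ⟨⟨b, hb.1⟩, by rw [SimpleGraph.mem_neighborFinset]; exact hb.2, rfl⟩

theorem turanNumber_add (n s : ℕ) :
    (turanNumber (n + s) s : ℝ) = turanNumber n s + n * (s - 1 : ℕ) + (s.choose 2 : ℕ) := by
  have := SimpleGraph.card_edgeFinset_turanGraph_add (n := n) (r := s)
  unfold turanNumber
  exact_mod_cast this

theorem turanNumber_le (n : ℕ) {s : ℕ} (hs : 1 ≤ s) :
    (turanNumber n s : ℝ) ≤ (1 - 1 / (s : ℝ)) * ((n : ℝ) ^ 2 / 2) := by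
  have h := SimpleGraph.mul_card_edgeFinset_turanGraph_le (n := n) (r := s)
  have h' : (2 * s * turanNumber n s : ℝ) ≤ (s - 1) * n ^ 2 := by
    have hc : ((s - 1 : ℕ) : ℝ) = s - 1 := by rw [Nat.cast_sub hs, Nat.cast_one]
    unfold turanNumber
    rw [← hc]
    exact_mod_cast h
  have hs' : (0 : ℝ) < s := by exact_mod_cast hs
  have e : (1 - 1 / (s : ℝ)) * ((n : ℝ) ^ 2 / 2) = ((s - 1) * n ^ 2) / (2 * s) := by
    field_simp
  rw [e, le_div_iff₀ (by positivity)]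
  linarith

/-- The quadratic main term satisfies the same recursion in steps of `s` as the Turán number, so the
error never exceeds that of the base cases `n < s`. -/
theorem le_turanNumber (n : ℕ) {s : ℕ} (hs : 1 ≤ s) :
    (1 - 1 / (s : ℝ)) * ((n : ℝ) ^ 2 / 2) - s ^ 2 ≤ turanNumber n s := by
  have hs' : (0 : ℝ) < s := by exact_mod_cast hs
  induction n using Nat.strong_induction_on with
  | _ n ih =>
    rcases lt_or_ge n s with h | h
    · have h1 : (n : ℝ) ≤ s := by exact_mod_cast h.le
      have h2 : (0 : ℝ) ≤ n := by positivity
      have h3 : (0 : ℝ) ≤ turanNumber n s := by positivity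
      have h4 : 0 < 1 / (s : ℝ) := by positivity
      nlinarith [mul_nonneg h4.le (sq_nonneg (n : ℝ))]
    · obtain ⟨m, rfl⟩ := Nat.exists_eq_add_of_le' h
      have := ih m (by omega)
      rw [turanNumber_add, Nat.cast_choose_two, Nat.cast_sub hs]
      push_cast
      have e : (1 - 1 / (s : ℝ)) * (((m : ℝ) + s) ^ 2 / 2) =
          (1 - 1 / (s : ℝ)) * ((m : ℝ) ^ 2 / 2) + m * (s - 1) + s * (s - 1) / 2 := by
        field_simp
        ring
      rw [e]
      linarith

theorem turanNumber_sub_le {n s : ℕ} (hs : 1 ≤ s) (hn : 1 ≤ n) :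
    (1 - 1 / (s : ℝ)) * n - (1 + s ^ 2) ≤ (turanNumber n s : ℝ) - turanNumber (n - 1) s := by
  have h1 := le_turanNumber n hs
  have h2 := turanNumber_le (n - 1) hs
  rw [Nat.cast_sub hn] at h2
  push_cast at h2
  have hs' : (1 : ℝ) ≤ s := by exact_mod_cast hs
  have h3 : 0 ≤ 1 - 1 / (s : ℝ) := by
    rw [sub_nonneg, div_le_one (by linarith)]
    exact hs'
  have h4 : 0 < 1 / (s : ℝ) := by positivity
  nlinarith

/-- Many edges give a large subset with large minimum degree that still has many edges. -/
theorem exists_subset_degIn_ge {s : ℕ} (hs : 1 ≤ s) {θ : ℝ} (hθ : 0 < θ) (hθ2 : θ ≤ 1 / 2) :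
    ∃ n₀ : ℕ, ∀ (G : SimpleGraph V) (U : Finset V), n₀ ≤ #U →
      2 * turanNumber #U s < dartCount G U →
      ∃ W ⊆ U, 2 * turanNumber #W s < dartCount G W ∧ θ * #U ≤ #W ∧
        ∀ v ∈ W, (1 - 1 / (s : ℝ) - 2 * θ) * #W ≤ degIn G W v := by
  classical
  obtain ⟨n₀, hn₀⟩ := exists_nat_ge ((1 + s ^ 2) / θ ^ 2 : ℝ)
  refine ⟨n₀ + 1, fun G U hU hG => ?_⟩
  have hn : (1 + s ^ 2 : ℝ) ≤ θ ^ 2 * #U := by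
    have : (n₀ : ℝ) ≤ #U := by exact_mod_cast (Nat.le_succ _).trans hU
    have := hn₀.trans this
    rw [div_le_iff₀ (by positivity)] at this
    linarith
  -- The required surplus over the Turán number grows by `2θ²|U|` with each deleted vertex. A vertex
  -- of too small degree could be deleted without destroying `Q`, so a smallest `W` with `Q` has
  -- large minimum degree.
  set Q : Finset V → Prop := fun W =>
    2 * (turanNumber #W s : ℝ) + 1 + 2 * (θ ^ 2 * #U) * (#U - #W) ≤ dartCount G W with hQ
  have hne : (U.powerset.filter Q).Nonempty := by
    refine ⟨U, mem_filter.2 ⟨mem_powerset_self U, ?_⟩⟩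
    simp only [hQ, sub_self, mul_zero, add_zero]
    exact_mod_cast hG
  obtain ⟨W, hW, hmin⟩ := exists_min_image _ (fun W : Finset V => #W) hne
  obtain ⟨hWU, hWQ⟩ := mem_filter.1 hW
  rw [mem_powerset] at hWU
  have hWc : (#W : ℝ) ≤ #U := by exact_mod_cast card_le_card hWU
  have hU0 : (0 : ℝ) < #U := by
    have : 0 < #U := by omega
    exact_mod_cast this
  have hT0 : (0 : ℝ) ≤ turanNumber #W s := by positivity
  -- Otherwise the accumulated surplus, at least `θ²|U|²`, would exceed the trivial bound `|W|²`.
  have hsize : θ * #U ≤ #W := by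
    by_contra! hlt
    have h1 : (dartCount G W : ℝ) ≤ (#W : ℝ) ^ 2 := by exact_mod_cast dartCount_le_sq G W
    simp only [hQ] at hWQ
    have h2 : (#W : ℝ) ^ 2 ≤ (θ * #U) ^ 2 := by gcongr
    have h3 : (#U : ℝ) / 2 ≤ #U - #W := by nlinarith
    have h4 : (θ ^ 2 * #U) * (#U / 2) ≤ (θ ^ 2 * #U) * (#U - #W) := by gcongr
    nlinarith
  refine ⟨W, hWU, ?_, hsize, fun v hv => ?_⟩
  · have h5 : (0 : ℝ) ≤ 2 * (θ ^ 2 * #U) * (#U - #W) :=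
      mul_nonneg (by positivity) (by linarith)
    have : (2 * turanNumber #W s : ℝ) < dartCount G W := by
      simp only [hQ] at hWQ
      linarith
    exact_mod_cast this
  · have hW1 : 1 ≤ #W := card_pos.2 ⟨v, hv⟩
    have hnot : ¬ Q (W.erase v) := by
      intro h
      have := hmin (W.erase v)
        (mem_filter.2 ⟨mem_powerset.2 ((erase_subset _ _).trans hWU), h⟩)
      rw [card_erase_of_mem hv] at this
      omega
    simp only [hQ, not_le, card_erase_of_mem hv] at hnot hWQ
    rw [Nat.cast_sub hW1] at hnot
    have hd := dartCount_erase G hv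
    have hd' : (dartCount G W : ℝ) = dartCount G (W.erase v) + 2 * degIn G W v := by
      exact_mod_cast hd
    have hT := turanNumber_sub_le hs hW1
    push_cast at hnot
    have h6 : θ * (θ * #U) ≤ θ * #W := by gcongr
    nlinarith

theorem exists_isNClique_of_lt_dartCount {s : ℕ} (G : SimpleGraph V) (U : Finset V)
    (h : 2 * turanNumber #U s < dartCount G U) : ∃ K ⊆ U, G.IsNClique (s + 1) K := by
  classical
  set G' := G.comap (Subtype.val : U → V) with hG'
  have h1 : ¬ G'.CliqueFree (s + 1) := by
    intro hf
    have h3 := hf.card_edgeFinset_le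
    simp only at h3
    rw [← two_mul_ncard_edgeSet_comap, ← hG', ← SimpleGraph.coe_edgeFinset,
      Set.ncard_coe_finset] at h
    rw [← SimpleGraph.card_edgeFinset_turanGraph, Fintype.card_coe] at h3
    unfold turanNumber at h
    omega
  unfold SimpleGraph.CliqueFree at h1
  push Not at h1
  obtain ⟨K, hK⟩ := h1
  refine ⟨K.map (Function.Embedding.subtype _), fun x hx => ?_, ?_⟩
  · obtain ⟨y, -, rfl⟩ := mem_map.1 hx
    exact y.2
  · rw [SimpleGraph.isNClique_iff] at hK ⊢
    refine ⟨?_, by rw [card_map, hK.2]⟩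
    intro x hx y hy hxy
    simp only [coe_map, Set.mem_image, mem_coe] at hx hy
    obtain ⟨x, hx, rfl⟩ := hx
    obtain ⟨y, hy, rfl⟩ := hy
    exact hK.1 hx hy (fun h => hxy (by rw [h]))

end Graph

/-! ### Pigeonhole and averaging tools for blow-ups -/

section Blowup

variable {V ι C : Type*}

/-- Greedy selection of an independent set in a graph of bounded degree. -/
theorem exists_independent_subset (H : SimpleGraph V) (D m : ℕ) (Y : Finset V)
    (hD : ∀ v ∈ Y, degIn H Y v ≤ D) (hY : m * (D + 1) ≤ #Y) :
    ∃ Z ⊆ Y, #Z = m ∧ ∀ x ∈ Z, ∀ y ∈ Z, ¬ H.Adj x y := by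
  classical
  induction m generalizing Y with
  | zero => exact ⟨∅, empty_subset _, rfl, by simp⟩
  | succ m ih =>
    rw [add_mul, one_mul] at hY
    obtain ⟨y, hy⟩ : Y.Nonempty := card_pos.1 (by omega)
    set Y' := {x ∈ Y.erase y | ¬ H.Adj y x} with hY'
    have hsub : Y' ⊆ Y := (filter_subset _ _).trans (erase_subset _ _)
    have h1 : #Y = #Y' + #{x ∈ Y.erase y | H.Adj y x} + 1 := by
      rw [← card_erase_add_one hy,
        ← card_filter_add_card_filter_not (s := Y.erase y) (fun x => H.Adj y x)]
      simp only [hY']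
      omega
    have h2 : #{x ∈ Y.erase y | H.Adj y x} ≤ D :=
      (card_le_card (filter_subset_filter _ (erase_subset _ _))).trans (hD y hy)
    obtain ⟨Z, hZ, hZm, hZi⟩ := ih Y'
      (fun v hv => (degIn_mono le_rfl hsub v).trans (hD v (hsub hv))) (by omega)
    have hyZ : y ∉ Z := fun h => by simpa [hY'] using hZ h
    have hyn : ∀ x ∈ Z, ¬ H.Adj y x := fun x hx => (mem_filter.1 (hZ hx)).2
    refine ⟨insert y Z, insert_subset hy (hZ.trans hsub), by rw [card_insert_of_notMem hyZ, hZm],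
      fun a ha b hb => ?_⟩
    rcases mem_insert.1 ha with rfl | ha' <;> rcases mem_insert.1 hb with rfl | hb'
    · exact H.loopless.irrefl _
    · exact hyn b hb'
    · exact fun h => hyn a ha' h.symm
    · exact hZi a ha' b hb'

/-- At most `#I * M * D` vertices of `Y` conflict with some `X i`. The others are sorted by their
pattern of chosen subsets and colours, of which there are at most `(2 ^ M * |C|) ^ #I`. A pattern
shared by `m * (D + 1)` vertices leaves room for the greedy choice of `m` conflict-free ones. -/
theorem exists_uniform_extension_of_card [Fintype C] [Nonempty C]
    {R : C → SimpleGraph V} {H : SimpleGraph V} {U : Finset V} {I : Finset ι} {X : ι → Finset V}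
    {z : ι → ℕ} {Y : Finset V} {D m M : ℕ} (hm : 1 ≤ m) (hYU : Y ⊆ U) (hXU : ∀ i ∈ I, X i ⊆ U)
    (hY : ∀ y ∈ Y, ∀ i ∈ I, ∃ Z ⊆ X i, #Z = z i ∧ ∃ l, ∀ x ∈ Z, (R l).Adj y x)
    (hD : ∀ v ∈ U, degIn H U v ≤ D) (hM : ∀ i ∈ I, #(X i) ≤ M)
    (hcard : #I * M * D + (2 ^ M * Fintype.card C) ^ #I * (m * (D + 1)) ≤ #Y) :
    ∃ (Z : ι → Finset V) (l : ι → C), ∃ Y' ⊆ Y, #Y' = m ∧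
      (∀ i ∈ I, Z i ⊆ X i ∧ #(Z i) = z i ∧
        ∀ y ∈ Y', ∀ x ∈ Z i, (R (l i)).Adj y x ∧ ¬ H.Adj y x) ∧
      ∀ x ∈ Y', ∀ y ∈ Y', ¬ H.Adj x y := by
  classical
  choose! Z hZX hZc l hl using hY
  set Y₀ := {y ∈ Y | ∀ i ∈ I, ∀ x ∈ X i, ¬ H.Adj y x} with hY₀
  have h0 : #Y ≤ #Y₀ + #I * M * D := by
    rw [← card_filter_add_card_filter_not (s := Y) (fun y => ∀ i ∈ I, ∀ x ∈ X i, ¬ H.Adj y x)]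
    refine Nat.add_le_add_left ?_ _
    have hsub : {y ∈ Y | ¬ ∀ i ∈ I, ∀ x ∈ X i, ¬ H.Adj y x} ⊆
        (I.biUnion X).biUnion (fun x => {y ∈ U | H.Adj x y}) := by
      intro y hy
      obtain ⟨hy, h⟩ := mem_filter.1 hy
      push Not at h
      obtain ⟨i, hi, x, hx, h⟩ := h
      exact mem_biUnion.2 ⟨x, mem_biUnion.2 ⟨i, hi, hx⟩, mem_filter.2 ⟨hYU hy, h.symm⟩⟩
    refine (card_le_card hsub).trans ((card_biUnion_le_card_mul _ _ D ?_).trans ?_)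
    · intro x hx
      obtain ⟨i, hi, hx⟩ := mem_biUnion.1 hx
      exact hD x (hXU i hi hx)
    · exact Nat.mul_le_mul_right _ (card_biUnion_le_card_mul _ _ _ hM)
  set T : Finset ((i : ι) → i ∈ I → Finset V × C) :=
    I.pi fun i => (X i).powerset ×ˢ (univ : Finset C) with hT
  have hTc : #T ≤ (2 ^ M * Fintype.card C) ^ #I := by
    rw [hT, card_pi]
    refine prod_le_pow_card _ _ _ fun i hi => ?_
    rw [card_product, card_powerset, card_univ]
    gcongr
    · norm_num
    · exact hM i hi
  have hTn : T.Nonempty := by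
    obtain ⟨c⟩ := ‹Nonempty C›
    exact ⟨fun i _ => (∅, c), by simp [hT]⟩
  obtain ⟨τ, -, hτ⟩ := exists_le_card_fiber_of_mul_le_card_of_maps_to
    (s := Y₀) (t := T) (f := fun y i _ => (Z y i, l y i)) (n := m * (D + 1))
    (by
      intro y hy
      rw [hT, mem_pi]
      intro i hi
      simpa using hZX y (mem_filter.1 hy).1 i hi) hTn
    (by
      have := Nat.mul_le_mul_right (m * (D + 1)) hTc
      omega)
  set F := {y ∈ Y₀ | (fun i (_ : i ∈ I) => (Z y i, l y i)) = τ} with hF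
  have hFY : F ⊆ Y := (filter_subset _ _).trans (filter_subset _ _)
  obtain ⟨Y', hY'F, hY'm, hY'i⟩ := exists_independent_subset H D m F
    (fun v hv => (degIn_mono le_rfl (hFY.trans hYU) v).trans (hD v (hYU (hFY hv)))) hτ
  obtain ⟨y₀, hy₀⟩ : F.Nonempty := card_pos.1 (lt_of_lt_of_le (by positivity) hτ)
  refine ⟨Z y₀, l y₀, Y', hY'F.trans hFY, hY'm, fun i hi => ⟨hZX _ (hFY hy₀) i hi,
    hZc _ (hFY hy₀) i hi, fun y hy x hx => ?_⟩, hY'i⟩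
  have hy1 := mem_filter.1 (hY'F hy)
  have e := congrFun (congrFun (hy1.2.trans (mem_filter.1 hy₀).2.symm) i) hi
  simp only [Prod.mk.injEq] at e
  rw [← e.1] at hx
  rw [← e.2]
  exact ⟨hl y (hFY (hY'F hy)) i hi x hx,
    (mem_filter.1 hy1.1).2 i hi x (hZX y (hFY (hY'F hy)) i hi hx)⟩

/-- Among linearly many vertices `y` that see a large monochromatic part of each `X i`, one finds
`m` pairwise non-conflicting ones that see the same part in the same colour. -/
theorem exists_uniform_extension [Fintype C] [Nonempty C] (a M : ℕ) {m : ℕ} (hm : 1 ≤ m)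
    {γ : ℝ} (hγ : 0 < γ) :
    ∃ δ : ℝ, 0 < δ ∧ ∃ n₀ : ℕ, ∀ (R : C → SimpleGraph V) (H : SimpleGraph V) (U : Finset V)
      (I : Finset ι) (X : ι → Finset V) (z : ι → ℕ) (Y : Finset V),
      n₀ ≤ #U → (∀ v ∈ U, (degIn H U v : ℝ) ≤ δ * #U) → #I = a →
      (∀ i ∈ I, X i ⊆ U) → (∀ i ∈ I, #(X i) ≤ M) → Y ⊆ U → γ * #U ≤ #Y →
      (∀ y ∈ Y, ∀ i ∈ I, ∃ Z ⊆ X i, #Z = z i ∧ ∃ l, ∀ x ∈ Z, (R l).Adj y x) →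
      ∃ (Z : ι → Finset V) (l : ι → C), ∃ Y' ⊆ Y, #Y' = m ∧
        (∀ i ∈ I, Z i ⊆ X i ∧ #(Z i) = z i ∧
          ∀ y ∈ Y', ∀ x ∈ Z i, (R (l i)).Adj y x ∧ ¬ H.Adj y x) ∧
        ∀ x ∈ Y', ∀ y ∈ Y', ¬ H.Adj x y := by
  set T : ℕ := (2 ^ M * Fintype.card C) ^ a with hT
  set K : ℝ := a * M + T * m with hK
  have hK0 : 0 ≤ K := by positivity
  obtain ⟨n₀, hn₀⟩ := exists_nat_ge (2 * (T * m) / γ : ℝ)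
  -- Half of `γ|U|` pays for the terms proportional to the conflict degree `D`, the other half for
  -- the constant term `T * m`, which is small by the choice of `n₀`.
  refine ⟨γ / (2 * (K + 1)), by positivity, n₀, ?_⟩
  intro R H U I X z Y hU hH hI hXU hM hYU hγY hY
  set D : ℕ := ⌊γ / (2 * (K + 1)) * #U⌋₊ with hDdef
  have hD1 : (D : ℝ) ≤ γ / (2 * (K + 1)) * #U := Nat.floor_le (by positivity)
  refine exists_uniform_extension_of_card (D := D) hm hYU hXU hY (fun v hv => Nat.le_floor (hH v hv))
    hM ?_
  have h1 : (2 * (T * m) : ℝ) ≤ γ * #U := by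
    have : (n₀ : ℝ) ≤ #U := by exact_mod_cast hU
    have := hn₀.trans this
    rw [div_le_iff₀ hγ] at this
    linarith
  have h2 : K * D ≤ γ * #U / 2 := by
    have h3 : (K + 1) * (γ / (2 * (K + 1)) * #U) = γ * #U / 2 := by field_simp
    have h4 : (K + 1) * (D : ℝ) ≤ γ * #U / 2 := by
      rw [← h3]
      gcongr
    have : (0 : ℝ) ≤ D := by positivity
    linarith
  have : ((#I * M * D + (2 ^ M * Fintype.card C) ^ #I * (m * (D + 1)) : ℕ) : ℝ) ≤ #Y := by
    rw [hI, ← hT]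
    push_cast
    rw [hK] at h2
    linarith
  exact_mod_cast this

open scoped Classical in
/-- The proportion of the vertices in `X` that are not adjacent to `y`. -/
noncomputable def missing (G : SimpleGraph V) (X : Finset V) (y : V) : ℝ :=
  #{x ∈ X | ¬ G.Adj y x} / #X

theorem missing_nonneg (G : SimpleGraph V) (X : Finset V) (y : V) : 0 ≤ missing G X y := by
  unfold missing
  positivity

theorem degIn_eq_of_nonempty (G : SimpleGraph V) {X : Finset V} (hX : X.Nonempty) (y : V) :
    (degIn G X y : ℝ) = (1 - missing G X y) * #X := by
  classical
  have h := card_filter_add_card_filter_not (s := X) (G.Adj y)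
  have h' : (degIn G X y : ℝ) + #{x ∈ X | ¬ G.Adj y x} = #X := by
    unfold degIn
    exact_mod_cast h
  have h0 : (#X : ℝ) ≠ 0 := by exact_mod_cast (card_pos.2 hX).ne'
  unfold missing
  field_simp
  linarith

/-- Double counting of the non-adjacent pairs between `X` and `U`. -/
theorem sum_missing_le (G : SimpleGraph V) {U X : Finset V} {ρ : ℝ} (hX : X.Nonempty)
    (hXU : X ⊆ U) (hG : ∀ v ∈ U, (1 - ρ) * #U ≤ degIn G U v) :
    ∑ y ∈ U, missing G X y ≤ ρ * #U := by
  classical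
  have h0 : (0 : ℝ) < #X := by exact_mod_cast card_pos.2 hX
  have h1 : ∑ y ∈ U, #{x ∈ X | ¬ G.Adj y x} = ∑ x ∈ X, #{y ∈ U | ¬ G.Adj x y} := by
    simp only [card_filter]
    rw [sum_comm]
    simp only [G.adj_comm]
  have h2 : ∀ x ∈ X, (#{y ∈ U | ¬ G.Adj x y} : ℝ) ≤ ρ * #U := by
    intro x hx
    have h3 := card_filter_add_card_filter_not (s := U) (G.Adj x)
    have h4 : (degIn G U x : ℝ) + #{y ∈ U | ¬ G.Adj x y} = #U := by
      unfold degIn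
      exact_mod_cast h3
    linarith [hG x (hXU hx)]
  unfold missing
  rw [← sum_div, div_le_iff₀ h0, ← Nat.cast_sum, h1, Nat.cast_sum]
  refine (sum_le_sum h2).trans (le_of_eq ?_)
  rw [sum_const, nsmul_eq_mul]
  ring

open scoped Classical in
/-- Most vertices miss few of the weighted classes. -/
theorem card_filter_missing_ge (G : SimpleGraph V) {U : Finset V} {I : Finset ι} {X : ι → Finset V}
    {wt : ι → ℝ} {ρ Ω : ℝ} {s : ℕ} (hs : 1 ≤ s) (hwt : ∀ i ∈ I, 0 ≤ wt i)
    (hX : ∀ i ∈ I, (X i).Nonempty) (hXU : ∀ i ∈ I, X i ⊆ U)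
    (hG : ∀ v ∈ U, (1 - ρ) * #U ≤ degIn G U v)
    (hΩ : ∑ i ∈ I, wt i = Ω) (hρΩ : ρ * Ω ≤ 2 - 3 / (4 * s)) :
    1 / (4 * s : ℝ) * #U ≤
      #{y ∈ U | ∑ i ∈ I, wt i * missing G (X i) y < 2 - 1 / (4 * s)} := by
  have hs' : (1 : ℝ) ≤ s := by exact_mod_cast hs
  set β : ℝ := 2 - 1 / (4 * s) with hβ
  set q : ℝ := 1 / (4 * s) with hq
  have hq0 : 0 < q := by positivity
  have hq1 : q ≤ 1 / 4 := by
    rw [hq]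
    apply one_div_le_one_div_of_le <;> linarith
  have h3q : (3 / (4 * s) : ℝ) = 3 * q := by rw [hq]; ring
  have h1 := card_filter_add_card_filter_not (s := U)
    (fun y => ∑ i ∈ I, wt i * missing G (X i) y < β)
  set good := #{y ∈ U | ∑ i ∈ I, wt i * missing G (X i) y < β}
  set bad := #{y ∈ U | ¬ ∑ i ∈ I, wt i * missing G (X i) y < β} with hbad
  have h2 : β * bad ≤ ρ * Ω * #U := by
    calc β * bad = ∑ y ∈ U with ¬ ∑ i ∈ I, wt i * missing G (X i) y < β, β := by
          rw [sum_const, nsmul_eq_mul, mul_comm]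
      _ ≤ ∑ y ∈ U with ¬ ∑ i ∈ I, wt i * missing G (X i) y < β,
            ∑ i ∈ I, wt i * missing G (X i) y :=
          sum_le_sum fun y hy => not_lt.1 (mem_filter.1 hy).2
      _ ≤ ∑ y ∈ U, ∑ i ∈ I, wt i * missing G (X i) y :=
          sum_le_sum_of_subset_of_nonneg (filter_subset _ _) fun y _ _ =>
            sum_nonneg fun i hi => mul_nonneg (hwt i hi) (missing_nonneg _ _ _)
      _ = ∑ i ∈ I, wt i * ∑ y ∈ U, missing G (X i) y := by
          rw [sum_comm]
          simp only [mul_sum]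
      _ ≤ ∑ i ∈ I, wt i * (ρ * #U) :=
          sum_le_sum fun i hi => mul_le_mul_of_nonneg_left
            (sum_missing_le G (hX i hi) (hXU i hi) hG) (hwt i hi)
      _ = ρ * Ω * #U := by
          rw [← sum_mul, hΩ]
          ring
  have h1' : (good : ℝ) + bad = #U := by exact_mod_cast h1
  have hU0 : (0 : ℝ) ≤ #U := by positivity
  have h4 : β * bad ≤ β * ((1 - q) * #U) := by
    refine h2.trans ?_
    -- This is Markov's inequality with `β = 2 - q`: `(2 - q)(1 - q) ≥ 2 - 3q`.
    have : ρ * Ω ≤ β * (1 - q) := by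
      rw [hβ]
      nlinarith
    calc ρ * Ω * #U ≤ β * (1 - q) * #U := by gcongr
      _ = _ := by ring
  have h5 := le_of_mul_le_mul_left h4 (by rw [hβ]; linarith)
  linarith

theorem exists_monochromatic_subset [Fintype C] [Nonempty C] (R : C → SimpleGraph V)
    (X : Finset V) (y : V) (m : ℕ) (h : Fintype.card C * m ≤ degIn (⨆ l, R l) X y) :
    ∃ Z ⊆ X, #Z = m ∧ ∃ l, ∀ x ∈ Z, (R l).Adj y x := by
  classical
  have hc : ∀ x ∈ {x ∈ X | (⨆ l, R l).Adj y x}, ∃ l, (R l).Adj y x := by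
    intro x hx
    simpa using (mem_filter.1 hx).2
  choose! l hl using hc
  obtain ⟨c, -, hc⟩ := exists_le_card_fiber_of_mul_le_card_of_maps_to
    (s := {x ∈ X | (⨆ l, R l).Adj y x}) (t := univ) (f := l) (n := m)
    (fun _ _ => mem_univ _) univ_nonempty (by
      rw [card_univ]
      unfold degIn at h
      convert h)
  obtain ⟨Z, hZ, hZm⟩ := exists_subset_card_eq hc
  refine ⟨Z, hZ.trans ((filter_subset _ _).trans (filter_subset _ _)), hZm, c, fun x hx => ?_⟩
  have := mem_filter.1 (hZ hx)
  rw [← this.2]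
  exact hl x this.1

/-- A family of vertex sets in `U`: those indexed by `B` have `m` elements, the others are
single vertices, each pair that involves an index in `B` is completely joined in one colour, and the
only conflicts are between single vertices. -/
structure IsBlowup (R : C → SimpleGraph V) (H : SimpleGraph V) (U : Finset V) (m : ℕ)
    (B : Finset ι) (X : ι → Finset V) : Prop where
  subset : ∀ i, X i ⊆ U
  card_of_mem : ∀ i ∈ B, #(X i) = m
  card_of_notMem : ∀ i ∉ B, #(X i) = 1
  adj : ∀ i ∈ B, ∀ j ≠ i, ∃ l, ∀ x ∈ X i, ∀ y ∈ X j, (R l).Adj x y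
  indep : ∀ i ∈ B, ∀ x ∈ X i, ∀ y ∈ X i, ¬ H.Adj x y
  not_adj : ∀ i ∈ B, ∀ j ≠ i, ∀ x ∈ X i, ∀ y ∈ X j, ¬ H.Adj x y

/-- The single vertices of a blow-up are pairwise adjacent. -/
def SinglesAdj (R : C → SimpleGraph V) (B : Finset ι) (X : ι → Finset V) : Prop :=
  ∀ i ∉ B, ∀ j ∉ B, i ≠ j → ∃ l, ∀ x ∈ X i, ∀ y ∈ X j, (R l).Adj x y

theorem IsBlowup.adj_all {R : C → SimpleGraph V} {H : SimpleGraph V} {U : Finset V} {m : ℕ}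
    {B : Finset ι} {X : ι → Finset V} (h : IsBlowup R H U m B X) (h' : SinglesAdj R B X) {i j : ι}
    (hij : i ≠ j) : ∃ l, ∀ x ∈ X i, ∀ y ∈ X j, (R l).Adj x y := by
  by_cases hi : i ∈ B
  · exact h.adj i hi j hij.symm
  · by_cases hj : j ∈ B
    · obtain ⟨l, hl⟩ := h.adj j hj i hij
      exact ⟨l, fun x hx y hy => (hl y hy x hx).symm⟩
    · exact h' i hi j hj hij

end Blowup

/-! ### Growing a clique into a blow-up -/

section BlowupStep

variable {V ι C : Type*}

/-- Here `b` is the total weight of the classes, and the first factor bounds the proportion of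
vertices that any vertex misses. A total weight of at most `2s - 1` keeps the average weighted loss
below `2`, with a margin for `card_filter_missing_ge`. -/
theorem rate_mul_le {s b : ℝ} (hs : 1 ≤ s) (hb : b ≤ 2 * s - 1) :
    (1 / s + 1 / (8 * s ^ 2)) * b ≤ 2 - 3 / (4 * s) := by
  have h1 : (1 / s + 1 / (8 * s ^ 2)) * b ≤ (1 / s + 1 / (8 * s ^ 2)) * (2 * s - 1) := by gcongr
  refine h1.trans ?_
  have e : 2 - 3 / (4 * s) - (1 / s + 1 / (8 * s ^ 2)) * (2 * s - 1) = 1 / (8 * s ^ 2) := by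
    field_simp
    ring
  have : 0 ≤ 1 / (8 * s ^ 2) := by positivity
  linarith

theorem le_degIn_of_missing_lt (G : SimpleGraph V) {X : Finset V} {y : V} {s c : ℕ} (hs : 1 ≤ s)
    (hc : 1 ≤ c) (hX : #X = 8 * s * c) (h : 2 * missing G X y < 2 - 1 / (4 * s)) :
    c ≤ degIn G X y := by
  have hX0 : X.Nonempty := card_pos.1 (by rw [hX]; positivity)
  have h1 := degIn_eq_of_nonempty G hX0 y
  rw [hX] at h1
  push_cast at h1
  have hs' : (0 : ℝ) < s := by exact_mod_cast hs
  have h2 : 1 / (8 * s : ℝ) ≤ 1 - missing G X y := by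
    have : (1 / (4 * s) : ℝ) = 2 * (1 / (8 * s)) := by field_simp; norm_num
    linarith
  have h3 : (c : ℝ) ≤ degIn G X y := by
    rw [h1]
    calc (c : ℝ) = 1 / (8 * s) * (8 * s * c) := by field_simp
      _ ≤ _ := by gcongr
  exact_mod_cast h3

theorem exists_adj_of_missing_lt_one (R : C → SimpleGraph V) {X : Finset V} {y : V} (hX : #X = 1)
    (h : missing (⨆ l, R l) X y < 1) : ∃ l, ∀ x ∈ X, (R l).Adj y x := by
  classical
  obtain ⟨x, rfl⟩ := card_eq_one.1 hX
  by_contra! hn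
  have : ¬ (⨆ l, R l).Adj y x := by
    rw [SimpleGraph.iSup_adj]
    rintro ⟨l, hl⟩
    obtain ⟨x', hx', h'⟩ := hn l
    rw [mem_singleton.1 hx'] at h'
    exact h' hl
  unfold missing at h
  rw [filter_singleton, if_pos this] at h
  simp at h

variable [Fintype C] [Nonempty C]

/-- One single vertex of a blow-up can be replaced by a large class. -/
theorem exists_isBlowup_insert [Fintype ι] [DecidableEq ι] {s m : ℕ} (hs : 1 ≤ s)
    (hι : Fintype.card ι = s + 1) (hm : 1 ≤ m) :
    ∃ δ : ℝ, 0 < δ ∧ ∃ n₀ : ℕ, ∀ (R : C → SimpleGraph V) (H : SimpleGraph V) (U : Finset V)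
      (B : Finset ι) (X : ι → Finset V),
      n₀ ≤ #U → (∀ v ∈ U, (degIn H U v : ℝ) ≤ δ * #U) →
      (∀ v ∈ U, (1 - (1 / (s : ℝ) + 1 / (8 * (s : ℝ) ^ 2))) * #U ≤ degIn (⨆ l, R l) U v) →
      #B + 2 ≤ s → IsBlowup R H U (8 * s * (Fintype.card C * m)) B X → SinglesAdj R B X →
      ∃ j ∉ B, ∃ X' : ι → Finset V, IsBlowup R H U m (insert j B) X' ∧
        SinglesAdj R (insert j B) X' := by
  classical
  have hs' : (1 : ℝ) ≤ s := by exact_mod_cast hs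
  have hC : 1 ≤ Fintype.card C := Fintype.card_pos
  set c := Fintype.card C * m with hc
  have hc1 : 1 ≤ c := Nat.mul_pos hC hm
  obtain ⟨δ, hδ, n₀, hext⟩ := exists_uniform_extension (V := V) (ι := ι) (C := C) s (8 * s * c) hm
    (γ := 1 / (4 * s) / (s + 1)) (by positivity)
  refine ⟨δ, hδ, n₀, fun R H U B X hU hH hG hB hX hSA => ?_⟩
  set G := ⨆ l, R l with hGdef
  have hXne : ∀ i, (X i).Nonempty := by
    intro i
    by_cases hi : i ∈ B
    · exact card_pos.1 (by rw [hX.card_of_mem i hi]; positivity)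
    · exact card_pos.1 (by rw [hX.card_of_notMem i hi]; norm_num)
  -- With these weights, a loss below `2` excludes missing all of a large class and excludes missing
  -- two single vertices. The total weight `s + 1 + #B` is at most `2s - 1` exactly when `#B + 2 ≤
  -- s`.
  set wt : ι → ℝ := fun i => if i ∈ B then 2 else 1 with hwt
  have hwt1 : ∀ i, 1 ≤ wt i := by
    intro i
    simp only [hwt]
    split_ifs <;> norm_num
  have hwtsum : ∑ i, wt i = (s + 1 : ℝ) + #B := by
    have : ∀ i, wt i = 1 + if i ∈ B then 1 else 0 := by
      intro i
      simp only [hwt]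
      split_ifs <;> norm_num
    simp only [this, sum_add_distrib, sum_const, card_univ, hι, sum_boole]
    simp
  have hB' : (#B : ℝ) + 2 ≤ s := by exact_mod_cast hB
  have hgood := card_filter_missing_ge G (I := univ) (X := X) (wt := wt) hs
    (fun i _ => zero_le_one.trans (hwt1 i)) (fun i _ => hXne i) (fun i _ => hX.subset i) hG hwtsum
    (rate_mul_le hs' (by linarith))
  set good := {y ∈ U | ∑ i, wt i * missing G (X i) y < 2 - 1 / (4 * s)} with hgooddef
  have hterm : ∀ y i, 0 ≤ wt i * missing G (X i) y := fun y i =>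
    mul_nonneg (zero_le_one.trans (hwt1 i)) (missing_nonneg _ _ _)
  have hBc : Bᶜ.Nonempty := by
    rw [← card_pos, card_compl, hι]
    omega
  -- A good vertex misses at most one single vertex `j`, and it can take the place of that one. If
  -- it misses none, `j` is arbitrary.
  have hex : ∀ y ∈ good, ∃ j ∈ Bᶜ, ∀ i ∉ B, i ≠ j → missing G (X i) y < 1 := by
    intro y hy
    have hy2 := (mem_filter.1 hy).2
    by_cases hall : ∀ i ∉ B, missing G (X i) y < 1
    · obtain ⟨j, hj⟩ := hBc
      exact ⟨j, hj, fun i hi _ => hall i hi⟩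
    · push Not at hall
      obtain ⟨j, hj, hjm⟩ := hall
      refine ⟨j, mem_compl.2 hj, fun i hi hij => ?_⟩
      by_contra! him
      have h1 : ∑ x ∈ {i, j}, wt x * missing G (X x) y ≤ ∑ x, wt x * missing G (X x) y :=
        sum_le_sum_of_subset_of_nonneg (subset_univ _) fun x _ _ => hterm y x
      rw [sum_pair hij] at h1
      have h2 : 1 ≤ wt i * missing G (X i) y := one_le_mul_of_one_le_of_one_le (hwt1 i) him
      have h3 : 1 ≤ wt j * missing G (X j) y := one_le_mul_of_one_le_of_one_le (hwt1 j) hjm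
      have h4 : (0 : ℝ) < 1 / (4 * s) := by positivity
      linarith
  have : Nonempty ι := ⟨hBc.choose⟩
  choose! f hfB hf using hex
  obtain ⟨j, hj, hjc⟩ := exists_le_card_fiber_of_nsmul_le_card_of_maps_to (s := good) (t := Bᶜ)
    (f := f) (b := 1 / (4 * s) / (s + 1) * (#U : ℝ)) hfB hBc (by
      rw [nsmul_eq_mul]
      have h1 : (#Bᶜ : ℝ) ≤ s + 1 := by
        have : #Bᶜ ≤ s + 1 := hι ▸ card_le_univ _
        exact_mod_cast this
      calc (#Bᶜ : ℝ) * (1 / (4 * s) / (s + 1) * #U)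
          ≤ (s + 1) * (1 / (4 * s) / (s + 1) * #U) := by gcongr
        _ = 1 / (4 * s) * #U := by field_simp
        _ ≤ _ := hgood)
  rw [mem_compl] at hj
  set Y := {y ∈ good | f y = j} with hYdef
  have hYU : Y ⊆ U := (filter_subset _ _).trans (filter_subset _ _)
  obtain ⟨Z, l, Y', hY'Y, hY'm, hZ, hY'i⟩ := hext R H U (univ.erase j) X
    (fun i => if i ∈ B then m else 1) Y hU hH (by rw [card_erase_of_mem (mem_univ j), card_univ, hι]
                                                  rfl)
    (fun i _ => hX.subset i)
    (by
      intro i _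
      by_cases hi : i ∈ B
      · exact (hX.card_of_mem i hi).le
      · rw [hX.card_of_notMem i hi]
        have : 1 ≤ s * c := Nat.mul_pos hs hc1
        nlinarith) hYU hjc
    (by
      intro y hy i hi
      have hij := ne_of_mem_erase hi
      obtain ⟨hyg, hyj⟩ := mem_filter.1 hy
      have hyb := (mem_filter.1 hyg).2
      by_cases hiB : i ∈ B
      · rw [if_pos hiB]
        refine exists_monochromatic_subset R _ _ _ ?_
        refine le_degIn_of_missing_lt G hs hc1 (hX.card_of_mem i hiB) (lt_of_le_of_lt ?_ hyb)
        have : 2 * missing G (X i) y = wt i * missing G (X i) y := by simp [hwt, hiB]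
        rw [this]
        exact single_le_sum (f := fun i => wt i * missing G (X i) y)
          (fun x _ => hterm y x) (mem_univ i)
      · rw [if_neg hiB]
        exact ⟨X i, Subset.rfl, hX.card_of_notMem i hiB,
          exists_adj_of_missing_lt_one R (hX.card_of_notMem i hiB)
            (hf y hyg i hiB (hyj.symm ▸ hij))⟩)
  have hZ' : ∀ i ≠ j, Z i ⊆ X i ∧ #(Z i) = (if i ∈ B then m else 1) ∧
      ∀ y ∈ Y', ∀ x ∈ Z i, (R (l i)).Adj y x ∧ ¬ H.Adj y x :=
    fun i hi => hZ i (mem_erase.2 ⟨hi, mem_univ i⟩)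
  set X' := Function.update Z j Y' with hX'
  have hXj : X' j = Y' := Function.update_self _ _ _
  have hXi : ∀ i ≠ j, X' i = Z i := fun i hi => Function.update_of_ne hi _ _
  have hadj : ∀ i i', i' ≠ i → ∃ l, ∀ x ∈ X' i, ∀ y ∈ X' i', (R l).Adj x y := by
    intro i i' hii
    rcases eq_or_ne i j with rfl | hi
    · rw [hXj, hXi i' hii]
      exact ⟨l i', fun x hx y hy => ((hZ' i' hii).2.2 x hx y hy).1⟩
    · rcases eq_or_ne i' j with rfl | hi'
      · rw [hXj, hXi i hi]
        exact ⟨l i, fun x hx y hy => ((hZ' i hi).2.2 y hy x hx).1.symm⟩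
      · obtain ⟨l', hl'⟩ := hX.adj_all hSA hii.symm
        rw [hXi i hi, hXi i' hi']
        exact ⟨l', fun x hx y hy => hl' x ((hZ' i hi).1 hx) y ((hZ' i' hi').1 hy)⟩
  refine ⟨j, hj, X', ⟨?_, ?_, ?_, fun i _ i' h => hadj i i' h, ?_, ?_⟩,
    fun i _ i' _ h => hadj i i' h.symm⟩
  · intro i
    rcases eq_or_ne i j with rfl | hi
    · rw [hXj]
      exact hY'Y.trans hYU
    · rw [hXi i hi]
      exact (hZ' i hi).1.trans (hX.subset i)
  · intro i hiB
    rcases eq_or_ne i j with rfl | hi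
    · rw [hXj, hY'm]
    · rw [hXi i hi, (hZ' i hi).2.1, if_pos (mem_of_mem_insert_of_ne hiB hi)]
  · intro i hiB
    rw [mem_insert, not_or] at hiB
    rw [hXi i hiB.1, (hZ' i hiB.1).2.1, if_neg hiB.2]
  · intro i hiB
    rcases eq_or_ne i j with rfl | hi
    · rw [hXj]
      exact hY'i
    · rw [hXi i hi]
      exact fun x hx y hy => hX.indep i (mem_of_mem_insert_of_ne hiB hi) x ((hZ' i hi).1 hx) y
        ((hZ' i hi).1 hy)
  · intro i hiB i' hii
    rcases eq_or_ne i j with rfl | hi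
    · rw [hXj, hXi i' hii]
      exact fun x hx y hy => ((hZ' i' hii).2.2 x hx y hy).2
    · rcases eq_or_ne i' j with rfl | hi'
      · rw [hXj, hXi i hi]
        exact fun x hx y hy h => ((hZ' i hi).2.2 y hy x hx).2 h.symm
      · rw [hXi i hi, hXi i' hi']
        exact fun x hx y hy => hX.not_adj i (mem_of_mem_insert_of_ne hiB hi) i' hii x
          ((hZ' i hi).1 hx) y ((hZ' i' hi').1 hy)

/-- Iteration of `exists_isBlowup_insert`, starting from the clique with only single vertices. Each
insertion shrinks the existing classes, so the induction is over all class sizes. It must stop at `s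
- 1` large classes, where the weight bound fails. -/
theorem exists_isBlowup_of_isNClique [Fintype ι] [DecidableEq ι] {s : ℕ} (hs : 1 ≤ s)
    (hι : Fintype.card ι = s + 1) (r : ℕ) (hr : r + 1 ≤ s) (m : ℕ) (hm : 1 ≤ m) :
    ∃ δ : ℝ, 0 < δ ∧ ∃ n₀ : ℕ, ∀ (R : C → SimpleGraph V) (H : SimpleGraph V) (U K : Finset V),
      n₀ ≤ #U → (∀ v ∈ U, (degIn H U v : ℝ) ≤ δ * #U) →
      (∀ v ∈ U, (1 - (1 / (s : ℝ) + 1 / (8 * (s : ℝ) ^ 2))) * #U ≤ degIn (⨆ l, R l) U v) →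
      K ⊆ U → (⨆ l, R l).IsNClique (s + 1) K →
      ∃ (B : Finset ι) (X : ι → Finset V), #B = r ∧ IsBlowup R H U m B X ∧ SinglesAdj R B X := by
  classical
  induction r generalizing m with
  | zero =>
    refine ⟨1, one_pos, 0, fun R H U K _ _ _ hKU hK => ?_⟩
    rw [SimpleGraph.isNClique_iff] at hK
    obtain e : ι ≃ K := Fintype.equivOfCardEq (by rw [hι, Fintype.card_coe, hK.2])
    refine ⟨∅, fun i => {(e i : V)}, rfl, ⟨?_, by simp, by simp, by simp, by simp, by simp⟩, ?_⟩
    · intro i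
      rw [singleton_subset_iff]
      exact hKU (e i).2
    · intro i _ j _ hij
      have := hK.1 (e i).2 (e j).2 (fun h => hij (e.injective (Subtype.ext h)))
      rw [SimpleGraph.iSup_adj] at this
      obtain ⟨l, hl⟩ := this
      exact ⟨l, by simpa using hl⟩
  | succ r ih =>
    have hC : 1 ≤ Fintype.card C := Fintype.card_pos
    obtain ⟨δ₁, hδ₁, n₁, h₁⟩ := ih (by omega) (8 * s * (Fintype.card C * m))
      (Nat.mul_pos (by omega) (Nat.mul_pos hC hm))
    obtain ⟨δ₂, hδ₂, n₂, h₂⟩ := exists_isBlowup_insert (V := V) (C := C) hs hι hm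
    refine ⟨min δ₁ δ₂, lt_min hδ₁ hδ₂, max n₁ n₂, fun R H U K hU hH hG hKU hK => ?_⟩
    obtain ⟨B, X, hB, hX, hSA⟩ := h₁ R H U K ((le_max_left _ _).trans hU)
      (fun v hv => (hH v hv).trans (by gcongr; exact min_le_left _ _)) hG hKU hK
    obtain ⟨j, hj, X', hX', hSA'⟩ := h₂ R H U B X ((le_max_right _ _).trans hU)
      (fun v hv => (hH v hv).trans (by gcongr; exact min_le_right _ _)) hG (by omega) hX hSA
    exact ⟨insert j B, X', by rw [card_insert_of_notMem hj, hB], hX', hSA'⟩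

/-- The two single vertices of a blow-up with all other classes large can be replaced by two
vertices without conflict. -/
theorem exists_isBlowup_not_adj [Fintype ι] [DecidableEq ι] {s m : ℕ} (hs : 1 ≤ s)
    (hι : Fintype.card ι = s + 1) (hm : 1 ≤ m) :
    ∃ δ : ℝ, 0 < δ ∧ ∃ n₀ : ℕ, ∀ (R : C → SimpleGraph V) (H : SimpleGraph V) (U : Finset V)
      (B : Finset ι) (X : ι → Finset V),
      n₀ ≤ #U → (∀ v ∈ U, (degIn H U v : ℝ) ≤ δ * #U) →
      (∀ v ∈ U, (1 - (1 / (s : ℝ) + 1 / (8 * (s : ℝ) ^ 2))) * #U ≤ degIn (⨆ l, R l) U v) →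
      #B + 1 = s → IsBlowup R H U (8 * s * (Fintype.card C * m)) B X →
      ∃ X' : ι → Finset V, IsBlowup R H U m B X' ∧
        ∀ i ∉ B, ∀ j ∉ B, i ≠ j → ∀ x ∈ X' i, ∀ y ∈ X' j, x ≠ y ∧ ¬ H.Adj x y := by
  classical
  have hs' : (1 : ℝ) ≤ s := by exact_mod_cast hs
  have hC : 1 ≤ Fintype.card C := Fintype.card_pos
  set c := Fintype.card C * m with hc
  have hc1 : 1 ≤ c := Nat.mul_pos hC hm
  obtain ⟨δ, hδ, n₀, hext⟩ := exists_uniform_extension (V := V) (ι := ι) (C := C) (s - 1)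
    (8 * s * c) one_le_two (γ := 1 / (4 * s)) (by positivity)
  refine ⟨δ, hδ, n₀, fun R H U B X hU hH hG hB hX => ?_⟩
  set G := ⨆ l, R l with hGdef
  have hB' : (#B : ℝ) + 1 = s := by exact_mod_cast hB
  -- The old single vertices are ignored, so the total weight is only `2(s - 1)`. The price is that
  -- the two new ones need not be adjacent.
  have hgood := card_filter_missing_ge G (I := B) (X := X) (wt := fun _ => 2) (Ω := #B * 2) hs
    (fun i _ => zero_le_two) (fun i hi => card_pos.1 (by rw [hX.card_of_mem i hi]; positivity))
    (fun i _ => hX.subset i) hG (by simp) (rate_mul_le hs' (by linarith))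
  obtain ⟨Z, l, Y', hY'Y, hY'm, hZ, hY'i⟩ := hext R H U B X (fun _ => m) _ hU hH
    (by omega) (fun i _ => hX.subset i) (fun i hi => (hX.card_of_mem i hi).le)
    (filter_subset _ _) hgood (by
      intro y hy i hi
      refine exists_monochromatic_subset R _ _ _ ?_
      refine le_degIn_of_missing_lt G hs hc1 (hX.card_of_mem i hi)
        (lt_of_le_of_lt ?_ (mem_filter.1 hy).2)
      exact single_le_sum (f := fun i => 2 * missing G (X i) y)
          (fun x _ => mul_nonneg zero_le_two (missing_nonneg _ _ _)) hi)
  have hBc : #Bᶜ = 2 := by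
    rw [card_compl, hι]
    omega
  obtain e : (Bᶜ : Finset ι) ≃ Y' := Fintype.equivOfCardEq (by
    rw [Fintype.card_coe, Fintype.card_coe, hBc, hY'm])
  set X' : ι → Finset V := fun i => if h : i ∈ B then Z i else {(e ⟨i, mem_compl.2 h⟩ : V)} with hX'
  have hXB : ∀ i ∈ B, X' i = Z i := fun i hi => by simp [hX', hi]
  have hXn : ∀ i ∉ B, X' i ⊆ Y' := fun i hi => by simp [hX', hi]
  refine ⟨X', ⟨?_, ?_, ?_, ?_, ?_, ?_⟩, ?_⟩
  · intro i
    by_cases hi : i ∈ B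
    · rw [hXB i hi]
      exact (hZ i hi).1.trans (hX.subset i)
    · exact (hXn i hi).trans (hY'Y.trans (filter_subset _ _))
  · intro i hi
    rw [hXB i hi, (hZ i hi).2.1]
  · intro i hi
    simp [hX', hi]
  · intro i hi j hij
    rw [hXB i hi]
    by_cases hj : j ∈ B
    · obtain ⟨l', hl'⟩ := hX.adj i hi j hij
      rw [hXB j hj]
      exact ⟨l', fun x hx y hy => hl' x ((hZ i hi).1 hx) y ((hZ j hj).1 hy)⟩
    · exact ⟨l i, fun x hx y hy => ((hZ i hi).2.2 y (hXn j hj hy) x hx).1.symm⟩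
  · intro i hi
    rw [hXB i hi]
    exact fun x hx y hy => hX.indep i hi x ((hZ i hi).1 hx) y ((hZ i hi).1 hy)
  · intro i hi j hij
    rw [hXB i hi]
    by_cases hj : j ∈ B
    · rw [hXB j hj]
      exact fun x hx y hy => hX.not_adj i hi j hij x ((hZ i hi).1 hx) y ((hZ j hj).1 hy)
    · exact fun x hx y hy h => ((hZ i hi).2.2 y (hXn j hj hy) x hx).2 h.symm
  · intro i hi j hj hij x hx y hy
    refine ⟨?_, hY'i x (hXn i hi hx) y (hXn j hj hy)⟩
    simp only [hX', hi, hj, dif_neg, not_false_eq_true, mem_singleton] at hx hy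
    rw [hx, hy]
    intro h
    have := e.injective (Subtype.ext h)
    simp only [Subtype.mk.injEq] at this
    exact hij this

/-- A graph with more edges than the `s`-partite Turán graph contains, up to two single vertices,
a uniformly coloured blow-up of a clique on `s + 1` vertices. -/
theorem exists_isBlowup_of_lt_dartCount [Fintype ι] [DecidableEq ι] {s : ℕ} (hs : 1 ≤ s)
    (hι : Fintype.card ι = s + 1) {m : ℕ} (hm : 1 ≤ m) :
    ∃ δ : ℝ, 0 < δ ∧ ∃ n₀ : ℕ, ∀ (R : C → SimpleGraph V) (H : SimpleGraph V) (U : Finset V),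
      n₀ ≤ #U → (∀ v ∈ U, (degIn H U v : ℝ) ≤ δ * #U) →
      2 * turanNumber #U s < dartCount (⨆ l, R l) U →
      ∃ (B : Finset ι), #B + 1 = s ∧
        (∃ M ≥ m, ∃ X : ι → Finset V, IsBlowup R H U M B X ∧ SinglesAdj R B X) ∧
        ∃ X : ι → Finset V, IsBlowup R H U m B X ∧
          ∀ i ∉ B, ∀ j ∉ B, i ≠ j → ∀ x ∈ X i, ∀ y ∈ X j, x ≠ y ∧ ¬ H.Adj x y := by
  have hC : 1 ≤ Fintype.card C := Fintype.card_pos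
  have hs' : (1 : ℝ) ≤ s := by exact_mod_cast hs
  have hM : m ≤ 8 * s * (Fintype.card C * m) := by
    calc m = 1 * (1 * m) := by ring
      _ ≤ _ := by gcongr; omega
  -- Chosen so that `2θ` is the slack `1 / (8s²)` allowed in `rate_mul_le`.
  set θ : ℝ := 1 / (16 * (s : ℝ) ^ 2) with hθdef
  have hθ : 0 < θ := by positivity
  have hθ2 : θ ≤ 1 / 2 := by
    apply one_div_le_one_div_of_le <;> nlinarith
  obtain ⟨n₁, h₁⟩ := exists_subset_degIn_ge (V := V) hs hθ hθ2
  obtain ⟨δ₂, hδ₂, n₂, h₂⟩ := exists_isBlowup_of_isNClique (V := V) (C := C) hs hι (s - 1)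
    (by omega) _ (hm.trans hM)
  obtain ⟨δ₃, hδ₃, n₃, h₃⟩ := exists_isBlowup_not_adj (V := V) (C := C) hs hι hm
  obtain ⟨n₄, hn₄⟩ := exists_nat_ge ((max n₂ n₃ : ℕ) / θ : ℝ)
  refine ⟨min δ₂ δ₃ * θ, mul_pos (lt_min hδ₂ hδ₃) hθ, max n₁ n₄, fun R H U hU hH hG => ?_⟩
  obtain ⟨W, hWU, hWG, hWc, hWd⟩ := h₁ (⨆ l, R l) U ((le_max_left _ _).trans hU) hG
  have hWn : max n₂ n₃ ≤ #W := by
    have h5 : (n₄ : ℝ) ≤ #U := by exact_mod_cast (le_max_right _ _).trans hU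
    have h6 := hn₄.trans h5
    rw [div_le_iff₀ hθ] at h6
    have : ((max n₂ n₃ : ℕ) : ℝ) ≤ #W := h6.trans (by linarith)
    exact_mod_cast this
  have hWH : ∀ v ∈ W, (degIn H W v : ℝ) ≤ min δ₂ δ₃ * #W := by
    intro v hv
    have h7 : (degIn H W v : ℝ) ≤ degIn H U v := by exact_mod_cast degIn_mono le_rfl hWU v
    refine h7.trans ((hH v (hWU hv)).trans ?_)
    rw [mul_assoc]
    exact mul_le_mul_of_nonneg_left hWc (lt_min hδ₂ hδ₃).le
  have hWd' : ∀ v ∈ W,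
      (1 - (1 / (s : ℝ) + 1 / (8 * (s : ℝ) ^ 2))) * #W ≤ degIn (⨆ l, R l) W v := by
    intro v hv
    have e : 1 - (1 / (s : ℝ) + 1 / (8 * (s : ℝ) ^ 2)) = 1 - 1 / (s : ℝ) - 2 * θ := by
      rw [hθdef]
      field_simp
      ring
    rw [e]
    exact hWd v hv
  have hmono : ∀ {M : ℕ} {B : Finset ι} {X : ι → Finset V},
      IsBlowup R H W M B X → IsBlowup R H U M B X := fun h =>
    ⟨fun i => (h.subset i).trans hWU, h.card_of_mem, h.card_of_notMem, h.adj, h.indep, h.not_adj⟩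
  obtain ⟨K, hKW, hK⟩ := exists_isNClique_of_lt_dartCount _ W hWG
  obtain ⟨B, X, hB, hX, hSA⟩ := h₂ R H W K ((le_max_left _ _).trans hWn)
    (fun v hv => (hWH v hv).trans (by gcongr; exact min_le_left _ _)) hWd' hKW hK
  obtain ⟨X', hX', hX'n⟩ := h₃ R H W B X ((le_max_right _ _).trans hWn)
    (fun v hv => (hWH v hv).trans (by gcongr; exact min_le_right _ _)) hWd' (by omega) hX
  exact ⟨B, by omega, ⟨_, hM, X, hmono hX, hSA⟩, X', hmono hX', hX'n⟩

end BlowupStep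

/-! ### Volume packing bounds and bounded cardinality -/

section Packing

open Metric MeasureTheory Module

/-- Volume bound for the number of `r`-separated points in a ball of radius `ρ`. -/
theorem card_le_of_separated_of_dist_le {d : ℕ} {s : Finset (EuclideanSpace ℝ (Fin d))}
    {x : EuclideanSpace ℝ (Fin d)} {ρ r : ℝ} (hr : 0 < r) (hρ : 0 ≤ ρ)
    (hs : ∀ p ∈ s, dist p x ≤ ρ) (h : ∀ p ∈ s, ∀ q ∈ s, p ≠ q → r ≤ dist p q) :
    (#s : ℝ) ≤ (2 * ρ / r + 1) ^ d := by
  set μ : Measure (EuclideanSpace ℝ (Fin d)) := volume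
  have hr2 : 0 < r / 2 := by positivity
  have hρ2 : 0 < ρ + r / 2 := by positivity
  have hdisj : Set.Pairwise (s : Set (EuclideanSpace ℝ (Fin d)))
      (Function.onFun Disjoint fun p => ball p (r / 2)) := by
    intro p hp q hq hpq
    apply ball_disjoint_ball
    linarith [h p hp q hq hpq]
  have hsub : ⋃ p ∈ s, ball p (r / 2) ⊆ ball x (ρ + r / 2) := by
    refine Set.iUnion₂_subset fun p hp => ball_subset_ball' ?_
    linarith [hs p hp]
  have h1 := measure_mono (μ := μ) hsub
  rw [measure_biUnion_finset hdisj fun p _ => measurableSet_ball] at h1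
  simp only [μ.addHaar_ball_of_pos _ hr2, μ.addHaar_ball_of_pos _ hρ2, sum_const, nsmul_eq_mul,
    ← mul_assoc] at h1
  have h2 := (ENNReal.mul_le_mul_iff_left (measure_ball_pos _ _ zero_lt_one).ne'
    measure_ball_lt_top.ne).1 h1
  have h3 := ENNReal.toReal_le_of_le_ofReal (by positivity) h2
  rw [ENNReal.toReal_mul, ENNReal.toReal_natCast, ENNReal.toReal_ofReal (by positivity),
    finrank_euclideanSpace_fin, ← le_div_iff₀ (by positivity), ← div_pow] at h3
  have e : (ρ + r / 2) / (r / 2) = 2 * ρ / r + 1 := by field_simp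
  rwa [e] at h3

/-- If all distances exceeded `η` times the diameter, the volume bound would limit the number of
points. -/
theorem exists_dist_le_mul_dist {d : ℕ} {X : Finset (EuclideanSpace ℝ (Fin d))} {η : ℝ}
    (hη : 0 < η) (hX1 : 1 < #X) (hX : (2 / η + 1) ^ d < #X) :
    ∃ p ∈ X, ∃ p' ∈ X, p ≠ p' ∧ ∃ x ∈ X, ∃ x' ∈ X, dist p p' ≤ η * dist x x' := by
  obtain ⟨a, ha, b, hb, hab⟩ := one_lt_card.1 hX1
  obtain ⟨⟨x, x'⟩, hx, hmax⟩ := exists_max_image (X ×ˢ X) (fun z => dist z.1 z.2)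
    ⟨(a, b), mk_mem_product ha hb⟩
  rw [mem_product] at hx
  have hpos : 0 < dist x x' :=
    (dist_pos.2 hab).trans_le (hmax (a, b) (mk_mem_product ha hb))
  by_contra! hn
  have h1 := card_le_of_separated_of_dist_le (s := X) (x := a) (mul_pos hη hpos) hpos.le
    (fun p hp => hmax (p, a) (mk_mem_product hp ha))
    (fun p hp q hq hpq => (hn p hp q hq hpq x hx.1 x' hx.2).le)
  have e : 2 * dist x x' / (η * dist x x') = 2 / η := by field_simp
  rw [e] at h1
  linarith

/-- Induction on the number of intervals. A maximal `t a / 2`-separated subset, for the largest `t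
a`, has at most `9 ^ d` points. The balls of radius `t a / 2` around it cover `P`, and inside each
of them the interval of `a` does not occur. -/
theorem card_le_of_dist_mem {d : ℕ} {κ : Type*} [DecidableEq κ] {t : κ → ℝ} (J : Finset κ)
    (ht : ∀ i ∈ J, 1 < t i) (P : Finset (EuclideanSpace ℝ (Fin d)))
    (hP : ∀ p ∈ P, ∀ q ∈ P, p ≠ q → ∃ i ∈ J, dist p q ∈ Set.Icc (t i) (t i + 1)) :
    #P ≤ (9 ^ d) ^ #J := by
  classical
  induction J using Finset.induction_on_max_value t generalizing P with
  | empty =>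
    simp only [notMem_empty, false_and, exists_false] at hP
    simp only [card_empty, pow_zero]
    exact card_le_one.2 fun p hp q hq => by_contra (hP p hp q hq)
  | insert a J haJ hmax ih =>
    have hta := ht a (mem_insert_self a J)
    have hle : ∀ i ∈ insert a J, t i ≤ t a := by
      intro i hi
      rcases mem_insert.1 hi with rfl | hi
      · exact le_rfl
      · exact hmax i hi
    obtain ⟨Q, hQ, hQmax⟩ := exists_max_image
      {Q ∈ P.powerset | ∀ p ∈ Q, ∀ q ∈ Q, p ≠ q → t a / 2 ≤ dist p q} (fun Q => #Q)
      ⟨∅, by simp⟩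
    rw [mem_filter, mem_powerset] at hQ
    have hQcard : #Q ≤ 9 ^ d := by
      rcases Q.eq_empty_or_nonempty with rfl | ⟨x, hx⟩
      · simp
      -- The radius `2 * t a` suffices because `1 < t a` gives `t a + 1 ≤ 2 * t a`.
      have h1 := card_le_of_separated_of_dist_le (s := Q) (x := x) (r := t a / 2) (ρ := 2 * t a)
        (by linarith) (by linarith) (fun p hp => by
          rcases eq_or_ne p x with rfl | hpx
          · rw [dist_self]
            linarith
          · obtain ⟨i, hi, h⟩ := hP p (hQ.1 hp) x (hQ.1 hx) hpx
            linarith [h.2, hle i hi]) hQ.2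
      have e : 2 * (2 * t a) / (t a / 2) + 1 = 9 := by
        have : t a ≠ 0 := by linarith
        field_simp
        norm_num
      rw [e] at h1
      exact_mod_cast h1
    have hcov : P ⊆ Q.biUnion fun q => {p ∈ P | dist p q < t a / 2} := by
      intro p hp
      by_contra hn
      simp only [mem_biUnion, mem_filter, not_exists, not_and, not_lt] at hn
      have hpQ : p ∉ Q := fun h => by
        have := hn p h hp
        rw [dist_self] at this
        linarith
      have := hQmax (insert p Q) (by
        rw [mem_filter, mem_powerset]
        refine ⟨insert_subset hp hQ.1, fun x hx y hy hxy => ?_⟩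
        rcases mem_insert.1 hx with rfl | hx' <;> rcases mem_insert.1 hy with rfl | hy'
        · exact absurd rfl hxy
        · exact hn y hy' hp
        · rw [dist_comm]
          exact hn x hx' hp
        · exact hQ.2 x hx' y hy' hxy)
      rw [card_insert_of_notMem hpQ] at this
      omega
    have hball : ∀ q ∈ Q, #{p ∈ P | dist p q < t a / 2} ≤ (9 ^ d) ^ #J := by
      intro q _
      refine ih (fun i hi => ht i (mem_insert_of_mem hi)) _ fun x hx y hy hxy => ?_
      rw [mem_filter] at hx hy
      obtain ⟨i, hi, h⟩ := hP x hx.1 y hy.1 hxy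
      refine ⟨i, mem_of_mem_insert_of_ne hi ?_, h⟩
      rintro rfl
      have := dist_triangle_right x y q
      linarith [h.1, hx.2, hy.2]
    rw [card_insert_of_notMem haJ, pow_succ']
    exact (card_le_card hcov).trans ((card_biUnion_le_card_mul _ _ _ hball).trans
      (Nat.mul_le_mul_right _ hQcard))

end Packing

theorem bddAbove_almostFlatCards (k d j : ℕ) : BddAbove (almostFlatCards k d j) := by
  classical
  refine ⟨(9 ^ d) ^ k, fun N hN => ?_⟩
  obtain ⟨P, rfl, ⟨-, t, ht, -, hP⟩, -⟩ := hN 1 one_pos 1 one_pos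
  have := card_le_of_dist_mem (t := t) univ (fun i _ => ht i) P
    (fun p hp q hq hpq => by simpa using hP p hp q hq hpq)
  simpa using this

theorem one_mem_almostFlatCards (k d j : ℕ) : 1 ∈ almostFlatCards k d j := by
  intro ε _ α _
  refine ⟨{0}, rfl, ⟨?_, fun i => 2 + i, fun i => ?_, fun i i' h => ?_, ?_⟩, {0}, by simp, ?_⟩
  · intro p hp q hq hpq
    rw [mem_singleton] at hp hq
    exact absurd (hp.trans hq.symm) hpq
  · have : (0 : ℝ) ≤ (i : ℕ) := by positivity
    linarith
  · have : ((i : ℕ) : ℝ) < (i' : ℕ) := by exact_mod_cast h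
    simpa using this
  · intro p hp q hq hpq
    rw [mem_singleton] at hp hq
    exact absurd (hp.trans hq.symm) hpq
  · exact fun p hp hp' => absurd hp hp'

theorem isGreatest_A (k d : ℕ) : IsGreatest (almostFlatCards k d (d - 1)) (A k d) :=
  ⟨Nat.sSup_mem ⟨1, one_mem_almostFlatCards k d _⟩ (bddAbove_almostFlatCards k d _),
    fun _ hN => le_csSup (bddAbove_almostFlatCards k d _) hN⟩

theorem one_le_A (k d : ℕ) : 1 ≤ A k d :=
  (isGreatest_A k d).2 (one_mem_almostFlatCards k d _)

/-! ### Almost flat sets from large classes -/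

section Flat

open InnerProductGeometry

variable {d : ℕ}

/-- The hyperplane through the origin with normal vector `n`. -/
noncomputable def hyperplane (n : EuclideanSpace ℝ (Fin d)) :
    AffineSubspace ℝ (EuclideanSpace ℝ (Fin d)) :=
  AffineSubspace.mk' 0 (Submodule.span ℝ {n})ᗮ

theorem isPlaneOfDim_hyperplane (hd : 1 ≤ d) {n : EuclideanSpace ℝ (Fin d)} (hn : n ≠ 0) :
    IsPlaneOfDim (d - 1) (hyperplane n) := by
  refine ⟨⟨0, AffineSubspace.self_mem_mk' _ _⟩, ?_⟩
  rw [hyperplane, AffineSubspace.direction_mk']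
  have : Fact (Module.finrank ℝ (EuclideanSpace ℝ (Fin d)) = d - 1 + 1) :=
    ⟨by rw [finrank_euclideanSpace_fin]; omega⟩
  exact Submodule.finrank_orthogonal_span_singleton hn

/-- The orthogonal projection `w` of `v` to the hyperplane is a witness: it differs from `v` by at
most `σ‖v‖`, and the cosine of its angle with `v` is `‖w‖ / ‖v‖ ≥ 1 - σ`. -/
theorem angleToPlane_hyperplane_le {v n : EuclideanSpace ℝ (Fin d)} {σ α : ℝ} (hv : v ≠ 0)
    (hn : n ≠ 0) (hσ : σ < 1) (hα0 : 0 ≤ α) (hα : α ≤ Real.pi) (hσα : Real.cos α ≤ 1 - σ)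
    (h : |inner ℝ v n| ≤ σ * (‖v‖ * ‖n‖)) : angleToPlane v (hyperplane n) ≤ α := by
  have hn0 : 0 < ‖n‖ := norm_pos_iff.2 hn
  have hv0 : 0 < ‖v‖ := norm_pos_iff.2 hv
  set w := v - (inner ℝ v n / ‖n‖ ^ 2) • n with hw
  have hwn : inner ℝ n w = 0 := by
    rw [hw, inner_sub_right, inner_smul_right, real_inner_self_eq_norm_sq, real_inner_comm]
    field_simp
    ring
  have hdiff : ‖v - w‖ ≤ σ * ‖v‖ := by
    have : v - w = (inner ℝ v n / ‖n‖ ^ 2) • n := by rw [hw]; abel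
    rw [this, norm_smul, Real.norm_eq_abs, abs_div, abs_of_pos (by positivity : 0 < ‖n‖ ^ 2)]
    calc |inner ℝ v n| / ‖n‖ ^ 2 * ‖n‖ = |inner ℝ v n| / ‖n‖ := by field_simp
      _ ≤ σ * (‖v‖ * ‖n‖) / ‖n‖ := by gcongr
      _ = σ * ‖v‖ := by field_simp
  have hwnorm : (1 - σ) * ‖v‖ ≤ ‖w‖ := by
    have := norm_sub_norm_le v w
    linarith
  have hw0 : 0 < ‖w‖ := lt_of_lt_of_le (mul_pos (by linarith) hv0) hwnorm
  have hwd : w ∈ (hyperplane n).direction := by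
    rw [hyperplane, AffineSubspace.direction_mk', Submodule.mem_orthogonal_singleton_iff_inner_right]
    exact hwn
  have hvw : inner ℝ v w = ‖w‖ ^ 2 := by
    have e : v = w + (inner ℝ v n / ‖n‖ ^ 2) • n := by rw [hw]; abel
    conv_lhs => rw [e]
    rw [inner_add_left, inner_smul_left, hwn, mul_zero, add_zero, real_inner_self_eq_norm_sq]
  have hbdd : BddBelow (Set.range fun u : {w : EuclideanSpace ℝ (Fin d) //
      w ∈ (hyperplane n).direction ∧ w ≠ 0} => angle v (u : EuclideanSpace ℝ (Fin d))) :=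
    ⟨0, by rintro _ ⟨u, rfl⟩; exact angle_nonneg _ _⟩
  refine (ciInf_le hbdd ⟨w, hwd, norm_pos_iff.1 hw0⟩).trans ?_
  simp only [angle]
  rw [hvw, ← Real.arccos_cos hα0 hα]
  refine Real.arccos_le_arccos (hσα.trans ?_)
  rw [sq, mul_div_mul_right _ _ hw0.ne', le_div_iff₀ hv0]
  exact hwnorm

/-- Two points at nearly the same distance from `q` and close to each other span a direction nearly
orthogonal to the direction of `q`. -/
theorem abs_inner_sub_le {p p' q : EuclideanSpace ℝ (Fin d)} {t w η : ℝ}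
    (hp : dist p q ∈ Set.Icc t (t + w)) (hp' : dist p' q ∈ Set.Icc t (t + w))
    (hw : w ≤ dist p q) (hwη : w ≤ η * dist p p') (hη : dist p p' ≤ 4 * η * dist p q) :
    |inner ℝ (p - q) (p - p')| ≤ 4 * η * (‖p - q‖ * ‖p - p'‖) := by
  rw [dist_eq_norm] at hp hp' hw hwη hη
  rw [dist_eq_norm] at hη
  have e : p' - q = (p - q) - (p - p') := by abel
  rw [e] at hp'
  set v := p - q
  set n := p - p'
  -- By the law of cosines, `2⟨v, n⟩` is `‖v‖² - ‖v - n‖²`, which is small since the two lengths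
  -- differ by at most `w`, plus `‖n‖²`, which is small since `n` is short compared with `v`.
  have h1 := norm_sub_sq_real v n
  have hv := norm_nonneg v
  have hn := norm_nonneg n
  have hvn := norm_nonneg (v - n)
  obtain ⟨a1, a2⟩ := hp
  obtain ⟨b1, b2⟩ := hp'
  have hw0 : 0 ≤ w := by linarith
  have h2 : |‖v‖ ^ 2 - ‖v - n‖ ^ 2| ≤ 3 * w * ‖v‖ := by
    have e2 : ‖v‖ ^ 2 - ‖v - n‖ ^ 2 = (‖v‖ - ‖v - n‖) * (‖v‖ + ‖v - n‖) := by ring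
    rw [e2, abs_mul, abs_of_nonneg (by positivity : 0 ≤ ‖v‖ + ‖v - n‖)]
    have h3 : |‖v‖ - ‖v - n‖| ≤ w := abs_le.2 ⟨by linarith, by linarith⟩
    have h4 : ‖v‖ + ‖v - n‖ ≤ 3 * ‖v‖ := by linarith
    calc _ ≤ w * (3 * ‖v‖) := by gcongr
      _ = _ := by ring
  have h5 : 3 * w * ‖v‖ ≤ 3 * η * (‖v‖ * ‖n‖) := by nlinarith
  have h6 : ‖n‖ ^ 2 ≤ 4 * η * (‖v‖ * ‖n‖) := by nlinarith
  have hηvn : 0 ≤ η * (‖v‖ * ‖n‖) := by nlinarith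
  rw [abs_le] at h2 ⊢
  constructor <;> nlinarith

/-- The scaling turns the width `w` into `ε / 2`. The other half of `ε` is spent on making the left
endpoints strictly increasing. -/
theorem isNearlyDistanceSet_image_smul {k : ℕ} {P : Finset (EuclideanSpace ℝ (Fin d))}
    [DecidableEq (EuclideanSpace ℝ (Fin d))]
    {t : Fin k → ℝ} {w D ε : ℝ} (hw : 0 < w) (hε : 0 < ε) (hwD : w ≤ ε / (2 * (2 + ε)) * D)
    (hD : ∀ p ∈ P, ∀ q ∈ P, p ≠ q → D ≤ dist p q)
    (ht : ∀ p ∈ P, ∀ q ∈ P, p ≠ q → ∃ i, dist p q ∈ Set.Icc (t i) (t i + w)) :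
    IsNearlyDistanceSet k ε (P.image fun p => (ε / (2 * w)) • p) := by
  set ρ := ε / (2 * w) with hρ
  have hρ0 : 0 < ρ := by positivity
  have hρw : ρ * w = ε / 2 := by rw [hρ]; field_simp
  have hρD : 2 + ε ≤ ρ * D := by
    have h1 := mul_le_mul_of_nonneg_left hwD hρ0.le
    rw [hρw] at h1
    have h2 : ρ * (ε / (2 * (2 + ε)) * D) = ε / 2 * (ρ * D / (2 + ε)) := by field_simp
    rw [h2] at h1
    have h3 : 1 ≤ ρ * D / (2 + ε) := by
      by_contra! h
      nlinarith
    rwa [one_le_div (by positivity)] at h3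
  have hdist : ∀ p q : EuclideanSpace ℝ (Fin d), dist (ρ • p) (ρ • q) = ρ * dist p q := by
    intro p q
    rw [dist_smul₀, Real.norm_eq_abs, abs_of_pos hρ0]
  -- Raising the endpoints to `ρ * D` loses no distance and keeps them above `1` after the shift by
  -- `ε / 2`. Sorting is needed because `t` is not assumed monotone; the terms `ε / 2 * (i / k)`
  -- then break ties.
  set u : Fin k → ℝ := fun i => max (ρ * t i) (ρ * D) with hu
  have hmono : Monotone (u ∘ Tuple.sort u) := Tuple.monotone_sort u
  have hfrac : ∀ i : Fin k, 0 ≤ (i : ℝ) / k ∧ (i : ℝ) / k ≤ 1 := by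
    intro i
    have hk : (0 : ℝ) < k := by exact_mod_cast i.pos
    refine ⟨by positivity, ?_⟩
    rw [div_le_one hk]
    exact_mod_cast i.is_lt.le
  refine ⟨?_, fun i => u (Tuple.sort u i) - ε / 2 + ε / 2 * ((i : ℝ) / k), fun i => ?_,
    fun i j hij => ?_, ?_⟩
  · intro p hp q hq hpq
    obtain ⟨p, hp', rfl⟩ := mem_image.1 hp
    obtain ⟨q, hq', rfl⟩ := mem_image.1 hq
    rw [hdist]
    have := mul_le_mul_of_nonneg_left (hD p hp' q hq' (fun h => hpq (by rw [h]))) hρ0.le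
    linarith
  · have h1 : ρ * D ≤ u (Tuple.sort u i) := le_max_right _ _
    have h2 := mul_nonneg (half_pos hε).le (hfrac i).1
    linarith
  · have h1 : u (Tuple.sort u i) ≤ u (Tuple.sort u j) := hmono hij.le
    have hk : (0 : ℝ) < k := by exact_mod_cast i.pos
    have h2 : (i : ℝ) / k < (j : ℝ) / k := by
      have : (i : ℝ) < (j : ℝ) := by exact_mod_cast hij
      gcongr
    have h3 := mul_lt_mul_of_pos_left h2 (half_pos hε)
    simp only
    linarith
  · intro p hp q hq hpq
    obtain ⟨p, hp', rfl⟩ := mem_image.1 hp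
    obtain ⟨q, hq', rfl⟩ := mem_image.1 hq
    have hpq' : p ≠ q := fun h => hpq (by rw [h])
    obtain ⟨i, hi⟩ := ht p hp' q hq' hpq'
    refine ⟨(Tuple.sort u).symm i, ?_⟩
    simp only [hdist, Equiv.apply_symm_apply]
    obtain ⟨h1, h2⟩ := hfrac ((Tuple.sort u).symm i)
    have h3 := mul_nonneg (half_pos hε).le h1
    have h4 := mul_le_mul_of_nonneg_left h2 (half_pos hε).le
    have h5 := mul_le_mul_of_nonneg_left (hD p hp' q hq' hpq') hρ0.le
    have h6 := mul_le_mul_of_nonneg_left hi.1 hρ0.le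
    have h7 := mul_le_mul_of_nonneg_left hi.2 hρ0.le
    have h8 : u i ≤ ρ * dist p q := max_le h6 h5
    have h9 : ρ * t i ≤ u i := le_max_left _ _
    constructor <;> linarith

/-- From classes of points with nearly constant large distances one can choose one point each so
that, after scaling, one gets an almost flat nearly `k`-distance set. -/
theorem exists_isAlmostFlat (hd : 2 ≤ d) (k : ℕ) {ε α : ℝ} (hε : 0 < ε) (hα : 0 < α) :
    ∃ κ : ℝ, 0 < κ ∧ κ ≤ 1 ∧ ∃ m : ℕ, 1 ≤ m ∧
      ∀ {ι : Type} [Fintype ι] [DecidableEq ι] (B : Finset ι)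
        (X : ι → Finset (EuclideanSpace ℝ (Fin d)))
        (t : Fin k → ℝ) (w D : ℝ), 0 < w → w ≤ κ * D → #Bᶜ ≤ 2 →
        (∀ i ∈ B, m ≤ #(X i)) → (∀ i, (X i).Nonempty) →
        (∀ i j, i ≠ j → ∃ l, ∀ x ∈ X i, ∀ y ∈ X j, dist x y ∈ Set.Icc (t l) (t l + w)) →
        (∀ i j, i ≠ j → ∀ x ∈ X i, ∀ y ∈ X j, D ≤ dist x y) →
        (∀ i ∈ B, ∀ x ∈ X i, ∀ y ∈ X i, x ≠ y → D ≤ dist x y) →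
        ∃ P : Finset (EuclideanSpace ℝ (Fin d)), #P = Fintype.card ι ∧
          IsNearlyDistanceSet k ε P ∧ IsAlmostFlat P (d - 1) α := by
  classical
  set α' := min α 1 with hα'
  have hα'0 : 0 < α' := lt_min hα one_pos
  have hα'1 : α' ≤ 1 := min_le_right _ _
  have hπ : α' ≤ Real.pi := hα'1.trans (by linarith [Real.pi_gt_three])
  -- Below, `σ = 4η` is half of `1 - cos α'`, as `angleToPlane_hyperplane_le` allows.
  set η := (1 - Real.cos α') / 8 with hη
  have hcos1 : Real.cos α' < 1 := by
    have := Real.cos_lt_cos_of_nonneg_of_le_pi le_rfl hπ hα'0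
    rwa [Real.cos_zero] at this
  have hcos0 : 0 < Real.cos α' :=
    Real.cos_pos_of_le_one (by rwa [abs_of_pos hα'0])
  have hη0 : 0 < η := by rw [hη]; linarith
  obtain ⟨m, hm⟩ := exists_nat_gt ((2 / η + 1) ^ d)
  refine ⟨min (min η (ε / (2 * (2 + ε)))) 1, lt_min (lt_min hη0 (by positivity)) one_pos,
    min_le_right _ _, m + 2, by omega, ?_⟩
  intro ι _ _ B X t w D hw hwD hB hm' hne ht hD hDi
  have hD0 : 0 < D := by
    by_contra! h
    have : min (min η (ε / (2 * (2 + ε)))) 1 * D ≤ 0 :=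
      mul_nonpos_of_nonneg_of_nonpos
        (lt_min (lt_min hη0 (by positivity)) one_pos).le h
    linarith
  have hwη : w ≤ η * D := hwD.trans (by
    gcongr
    exact (min_le_left _ _).trans (min_le_left _ _))
  have hwε : w ≤ ε / (2 * (2 + ε)) * D := hwD.trans (by
    gcongr
    exact (min_le_left _ _).trans (min_le_right _ _))
  have hw1 : w ≤ D := hwD.trans (mul_le_of_le_one_left hD0.le (min_le_right _ _))
  have hchoose : ∀ i, ∃ p ∈ X i, ∃ p' ∈ X i, i ∈ B → p ≠ p' ∧
      ∀ j ≠ i, ∀ y ∈ X j, dist p p' ≤ 4 * η * dist p y := by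
    intro i
    by_cases hi : i ∈ B
    · have hmi : ((m + 2 : ℕ) : ℝ) ≤ #(X i) := by exact_mod_cast hm' i hi
      push_cast at hmi
      obtain ⟨p, hp, p', hp', hpp, x, hx, x', hx', h⟩ := exists_dist_le_mul_dist (X := X i) hη0
        (by have := hm' i hi; omega) (by linarith)
      refine ⟨p, hp, p', hp', fun _ => ⟨hpp, fun j hj y hy => ?_⟩⟩
      obtain ⟨l, hl⟩ := ht i j hj.symm
      have h1 := (hl x hx y hy).2
      have h2 := (hl x' hx' y hy).2
      have h3 := (hl p hp y hy).1
      have h4 := hD i j hj.symm p hp y hy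
      have h5 := dist_triangle_right x x' y
      -- The diameter of `X i` is at most `2(t l + w)`, and both `t l` and `w` are at most `dist p
      -- y`.
      calc dist p p' ≤ η * dist x x' := h
        _ ≤ η * (4 * dist p y) := by gcongr; linarith
        _ = _ := by ring
    · obtain ⟨p, hp⟩ := hne i
      exact ⟨p, hp, p, hp, fun h => absurd h hi⟩
  choose p hp p' hp' hpp using hchoose
  have hpinj : Function.Injective p := by
    intro i j hij
    by_contra h
    have := hD i j h (p i) (hp i) (p j) (hp j)
    rw [hij, dist_self] at this
    linarith
  set ρ := ε / (2 * w) with hρ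
  have hρ0 : 0 < ρ := by positivity
  refine ⟨(univ.image p).image fun x => ρ • x, ?_, ?_, ?_⟩
  · rw [card_image_of_injective _ (smul_right_injective _ hρ0.ne'),
      card_image_of_injective _ hpinj, card_univ]
  · refine isNearlyDistanceSet_image_smul (t := t) hw hε hwε ?_ ?_
    · intro x hx y hy hxy
      obtain ⟨i, -, rfl⟩ := mem_image.1 hx
      obtain ⟨j, -, rfl⟩ := mem_image.1 hy
      exact hD i j (fun h => hxy (by rw [h])) _ (hp i) _ (hp j)
    · intro x hx y hy hxy
      obtain ⟨i, -, rfl⟩ := mem_image.1 hx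
      obtain ⟨j, -, rfl⟩ := mem_image.1 hy
      obtain ⟨l, hl⟩ := ht i j (fun h => hxy (by rw [h]))
      exact ⟨l, hl _ (hp i) _ (hp j)⟩
  · refine ⟨Bᶜ.image fun i => ρ • p i, card_image_le.trans hB, fun x hx hxE => Or.inr ⟨by omega, ?_⟩⟩
    obtain ⟨x, hx', rfl⟩ := mem_image.1 hx
    obtain ⟨i, -, rfl⟩ := mem_image.1 hx'
    have hi : i ∈ B := by
      by_contra h
      exact hxE (mem_image.2 ⟨i, mem_compl.2 h, rfl⟩)
    obtain ⟨hne', hclose⟩ := hpp i hi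
    have hn : p i - p' i ≠ 0 := sub_ne_zero.2 hne'
    refine ⟨hyperplane (p i - p' i), isPlaneOfDim_hyperplane (by omega) hn, fun y hy hyx => ?_⟩
    obtain ⟨y, hy', rfl⟩ := mem_image.1 hy
    obtain ⟨j, -, rfl⟩ := mem_image.1 hy'
    have hji : j ≠ i := fun h => hyx (by rw [h])
    obtain ⟨l, hl⟩ := ht i j hji.symm
    have hDij := hD i j hji.symm _ (hp i) _ (hp j)
    have hDpp := hDi i hi _ (hp i) _ (hp' i) hne'
    have hinner := abs_inner_sub_le (hl _ (hp i) _ (hp j)) (hl _ (hp' i) _ (hp j))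
      (hw1.trans hDij) (hwη.trans (by gcongr)) (hclose j hji _ (hp j))
    have hij : p i - p j ≠ 0 := sub_ne_zero.2 fun h => hji (hpinj h).symm
    refine (angleToPlane_hyperplane_le (σ := 4 * η) (α := α') ?_ hn ?_ hα'0.le hπ ?_ ?_).trans
      (min_le_left _ _)
    · rw [← smul_sub]
      exact smul_ne_zero hρ0.ne' hij
    · rw [hη]
      linarith
    · rw [hη]
      linarith
    · rw [← smul_sub, inner_smul_left, norm_smul, abs_mul, Real.norm_eq_abs]
      simp only [conj_trivial, abs_of_pos hρ0]
      nlinarith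

end Flat

/-! ### From a blow-up to an almost flat set, and the upper bound -/

section Main

variable {d : ℕ}

/-- The graph on the whole space joining distinct points at distance in `[a, a + w]`. -/
def annulusGraph (d : ℕ) (a w : ℝ) : SimpleGraph (EuclideanSpace ℝ (Fin d)) where
  Adj p q := p ≠ q ∧ dist p q ∈ Set.Icc a (a + w)
  symm := ⟨fun p q h => ⟨h.1.symm, by simpa only [dist_comm] using h.2⟩⟩
  loopless := ⟨fun _ h => h.1 rfl⟩

/-- The graph on the whole space joining distinct points at distance less than `r`. -/
def closeGraph (d : ℕ) (r : ℝ) : SimpleGraph (EuclideanSpace ℝ (Fin d)) where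
  Adj p q := p ≠ q ∧ dist p q < r
  symm := ⟨fun p q h => ⟨h.1.symm, by simpa only [dist_comm] using h.2⟩⟩
  loopless := ⟨fun _ h => h.1 rfl⟩

theorem nearGraph_eq_comap {k : ℕ} (S : Finset (EuclideanSpace ℝ (Fin d))) (t : Fin k → ℝ) (w : ℝ) :
    nearGraph S t w = (⨆ l, annulusGraph d (t l) w).comap (Subtype.val : S → _) := by
  ext p q
  simp only [nearGraph, annulusGraph, SimpleGraph.comap_adj, SimpleGraph.iSup_adj, ne_eq,
    Subtype.val_inj, exists_and_left]

theorem degIn_closeGraph_le {S : Finset (EuclideanSpace ℝ (Fin d))} (hS : IsSeparated S) {r : ℝ}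
    (hr : 0 ≤ r) (v : EuclideanSpace ℝ (Fin d)) :
    (degIn (closeGraph d r) S v : ℝ) ≤ (2 * r + 1) ^ d := by
  classical
  unfold degIn
  have := card_le_of_separated_of_dist_le (s := {u ∈ S | (closeGraph d r).Adj v u}) (x := v)
    one_pos hr (fun p hp => by
      rw [dist_comm]
      exact (mem_filter.1 hp).2.2.le)
    (fun p hp q hq hpq => hS p (mem_filter.1 hp).1 q (mem_filter.1 hq).1 hpq)
  rw [div_one] at this
  convert this

theorem nearPairMax_mono (k : ℕ) (hd : 1 ≤ d) (n : ℕ) {w w' : ℝ} (h : w ≤ w') :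
    nearPairMax k d n w ≤ nearPairMax k d n w' := by
  obtain ⟨S, hS, hsep, t, ht, htm, hM⟩ := (isGreatest_nearPairMax k d n hd w).1
  refine (isGreatest_nearPairMax k d n hd w').2 ⟨S, hS, hsep, t, ht, htm, hM.trans ?_⟩
  refine Set.ncard_le_ncard (SimpleGraph.edgeSet_mono ?_) (Set.toFinite _)
  rintro p q ⟨hpq, i, hi⟩
  exact ⟨hpq, i, hi.1, hi.2.trans (by linarith)⟩

/-- All distances that involve a large class are long, because conflicts there are excluded. Only
the distance between the two single points can be short. In that case it marks an annulus not used
by long distances, and the second blow-up works once that annulus is moved. -/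
theorem exists_almostFlat_of_isBlowup {k s m : ℕ} {P : Finset (EuclideanSpace ℝ (Fin d)) → Prop}
    {κ w D : ℝ} {t : Fin k → ℝ} {U : Finset (EuclideanSpace ℝ (Fin d))} {B : Finset (Fin (s + 1))}
    (hgeo : ∀ (B : Finset (Fin (s + 1))) (X : Fin (s + 1) → Finset (EuclideanSpace ℝ (Fin d)))
        (t : Fin k → ℝ) (w D : ℝ), 0 < w → w ≤ κ * D → #Bᶜ ≤ 2 →
        (∀ i ∈ B, m ≤ #(X i)) → (∀ i, (X i).Nonempty) →
        (∀ i j, i ≠ j → ∃ l, ∀ x ∈ X i, ∀ y ∈ X j, dist x y ∈ Set.Icc (t l) (t l + w)) →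
        (∀ i j, i ≠ j → ∀ x ∈ X i, ∀ y ∈ X j, D ≤ dist x y) →
        (∀ i ∈ B, ∀ x ∈ X i, ∀ y ∈ X i, x ≠ y → D ≤ dist x y) →
        ∃ Q : Finset (EuclideanSpace ℝ (Fin d)), #Q = Fintype.card (Fin (s + 1)) ∧ P Q)
    (hκ : κ ≤ 1) (hm : 1 ≤ m) (hw : 0 < w) (hD : 0 < D) (hwD : w ≤ κ * D) (hB : #B + 1 = s)
    (hX : ∃ M ≥ m, ∃ X, IsBlowup (fun l => annulusGraph d (t l) w) (closeGraph d (2 * D)) U M B X ∧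
      SinglesAdj (fun l => annulusGraph d (t l) w) B X)
    (hX' : ∃ X, IsBlowup (fun l => annulusGraph d (t l) w) (closeGraph d (2 * D)) U m B X ∧
      ∀ i ∉ B, ∀ j ∉ B, i ≠ j → ∀ x ∈ X i, ∀ y ∈ X j, x ≠ y ∧ ¬ (closeGraph d (2 * D)).Adj x y) :
    ∃ Q : Finset (EuclideanSpace ℝ (Fin d)), #Q = s + 1 ∧ P Q := by
  classical
  have hBc : #Bᶜ = 2 := by
    rw [card_compl, Fintype.card_fin]
    omega
  have hwD1 : w ≤ D := hwD.trans (mul_le_of_le_one_left hD.le hκ)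
  have hne : ∀ {M : ℕ} {X : Fin (s + 1) → Finset (EuclideanSpace ℝ (Fin d))}, m ≤ M →
      IsBlowup (fun l => annulusGraph d (t l) w) (closeGraph d (2 * D)) U M B X →
      ∀ i, (X i).Nonempty := by
    intro M X hM hX i
    by_cases hi : i ∈ B
    · exact card_pos.1 (by rw [hX.card_of_mem i hi]; omega)
    · exact card_pos.1 (by rw [hX.card_of_notMem i hi]; omega)
  have hfarI : ∀ {M : ℕ} {X : Fin (s + 1) → Finset (EuclideanSpace ℝ (Fin d))},
      IsBlowup (fun l => annulusGraph d (t l) w) (closeGraph d (2 * D)) U M B X →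
      ∀ i ∈ B, ∀ x ∈ X i, ∀ y ∈ X i, x ≠ y → D ≤ dist x y := by
    intro M X hX i hi x hx y hy hxy
    have := hX.indep i hi x hx y hy
    by_contra! h
    exact this ⟨hxy, by linarith⟩
  have hfar : ∀ {M : ℕ} {X : Fin (s + 1) → Finset (EuclideanSpace ℝ (Fin d))},
      IsBlowup (fun l => annulusGraph d (t l) w) (closeGraph d (2 * D)) U M B X →
      ∀ i ∈ B, ∀ j ≠ i, ∀ x ∈ X i, ∀ y ∈ X j, 2 * D ≤ dist x y := by
    intro M X hX i hi j hij x hx y hy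
    obtain ⟨l, hl⟩ := hX.adj i hi j hij
    have := hX.not_adj i hi j hij x hx y hy
    by_contra! h
    exact this ⟨(hl x hx y hy).1, h⟩
  obtain ⟨M, hM, X, hX, hSA⟩ := hX
  by_cases hlong : ∀ i ∉ B, ∀ j ∉ B, i ≠ j → ∀ x ∈ X i, ∀ y ∈ X j, D ≤ dist x y
  · rw [← Fintype.card_fin (s + 1)]
    refine hgeo B X t w D hw hwD hBc.le (fun i hi => by rw [hX.card_of_mem i hi]; exact hM)
      (hne hM hX) (fun i j hij => ?_) (fun i j hij x hx y hy => ?_) (hfarI hX)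
    · obtain ⟨l, hl⟩ := hX.adj_all hSA hij
      exact ⟨l, fun x hx y hy => (hl x hx y hy).2⟩
    · by_cases hi : i ∈ B
      · linarith [hfar hX i hi j hij.symm x hx y hy]
      · by_cases hj : j ∈ B
        · rw [dist_comm]
          linarith [hfar hX j hj i hij y hy x hx]
        · exact hlong i hi j hj hij x hx y hy
  · push Not at hlong
    obtain ⟨i₀, hi₀, j₀, hj₀, hij₀, x₀, hx₀, y₀, hy₀, hshort⟩ := hlong
    obtain ⟨l₀, hl₀⟩ := hSA i₀ hi₀ j₀ hj₀ hij₀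
    have htl₀ : t l₀ < D := (hl₀ x₀ hx₀ y₀ hy₀).2.1.trans_lt hshort
    obtain ⟨X', hX', hX'n⟩ := hX'
    obtain ⟨a, b, hab, habB⟩ := card_eq_two.1 hBc
    have haB : a ∉ B := by rw [← mem_compl, habB]; simp
    have hbB : b ∉ B := by rw [← mem_compl, habB]; simp
    have hBab : ∀ i ∉ B, i = a ∨ i = b := fun i hi => by
      rw [← mem_compl, habB] at hi
      simpa using hi
    obtain ⟨u, hu⟩ := card_eq_one.1 (hX'.card_of_notMem a haB)
    obtain ⟨v, hv⟩ := card_eq_one.1 (hX'.card_of_notMem b hbB)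
    -- The annulus of `l₀` ends below `D + w ≤ 2 * D`, so no join to a large class uses it. This is
    -- why conflicts are defined with `2 * D` and not `D`.
    set t' := Function.update t l₀ (dist u v) with ht'
    have hB1 : ∀ i ∈ B, ∀ j ≠ i, ∃ l, ∀ x ∈ X' i, ∀ y ∈ X' j,
        dist x y ∈ Set.Icc (t' l) (t' l + w) := by
      intro i hi j hij
      obtain ⟨l, hl⟩ := hX'.adj i hi j hij
      refine ⟨l, fun x hx y hy => ?_⟩
      have h1 := (hl x hx y hy).2
      have h2 := hfar hX' i hi j hij x hx y hy
      have h3 : l ≠ l₀ := by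
        rintro rfl
        linarith [h1.2]
      rw [ht', Function.update_of_ne h3]
      exact h1
    rw [← Fintype.card_fin (s + 1)]
    refine hgeo B X' t' w D hw hwD hBc.le (fun i hi => (hX'.card_of_mem i hi).ge)
      (hne le_rfl hX') (fun i j hij => ?_) (fun i j hij x hx y hy => ?_) (hfarI hX')
    · by_cases hi : i ∈ B
      · exact hB1 i hi j hij.symm
      by_cases hj : j ∈ B
      · obtain ⟨l, hl⟩ := hB1 j hj i hij
        exact ⟨l, fun x hx y hy => by rw [dist_comm]; exact hl y hy x hx⟩
      · refine ⟨l₀, fun x hx y hy => ?_⟩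
        have h1 : dist x y = dist u v := by
          rcases hBab i hi with rfl | rfl <;> rcases hBab j hj with rfl | rfl
          · exact absurd rfl hij
          · rw [hu, mem_singleton] at hx
            rw [hv, mem_singleton] at hy
            rw [hx, hy]
          · rw [hv, mem_singleton] at hx
            rw [hu, mem_singleton] at hy
            rw [hx, hy, dist_comm]
          · exact absurd rfl hij
        rw [ht', Function.update_self, h1]
        exact ⟨le_rfl, by linarith⟩
    · by_cases hi : i ∈ B
      · linarith [hfar hX' i hi j hij.symm x hx y hy]
      by_cases hj : j ∈ B
      · rw [dist_comm]
        linarith [hfar hX' j hj i hij y hy x hx]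
      · obtain ⟨h1, h2⟩ := hX'n i hi j hj hij x hx y hy
        by_contra! h
        exact h2 ⟨h1, by linarith⟩

/-- The Turán-type upper bound for wide intervals. -/
theorem exists_nearPairMax_le_turanNumber {k : ℕ} (hd : 2 ≤ d) (hk : 1 ≤ k) :
    ∃ c : ℝ, 0 < c ∧ ∃ n₀ : ℕ, ∀ n : ℕ, n₀ ≤ n →
      nearPairMax k d n (c * (n : ℝ) ^ (1 / (d : ℝ))) ≤ turanNumber n (A k d) := by
  classical
  have : Nonempty (Fin k) := ⟨⟨0, hk⟩⟩
  have hnot : A k d + 1 ∉ almostFlatCards k d (d - 1) := fun h => by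
    have := (isGreatest_A k d).2 h
    omega
  simp only [almostFlatCards, Set.mem_ofPred_eq] at hnot
  push Not at hnot
  obtain ⟨ε, hε, α, hα, hno⟩ := hnot
  obtain ⟨κ, hκ0, hκ1, m, hm, hgeo⟩ := exists_isAlmostFlat hd k hε hα
  obtain ⟨δ, hδ, n₁, hgraph⟩ := exists_isBlowup_of_lt_dartCount
    (V := EuclideanSpace ℝ (Fin d)) (C := Fin k) (ι := Fin (A k d + 1)) (one_le_A k d)
    (Fintype.card_fin _) hm
  -- For `D ≥ 1` the conflict degree is at most `(4D + 1) ^ d ≤ (5D) ^ d = (5c') ^ d * n`, which is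
  -- at most `δ * n`.
  set c' := min δ 1 / 5 with hc'
  have hc'0 : 0 < c' := by
    have := lt_min hδ one_pos
    positivity
  have hd0 : d ≠ 0 := by omega
  obtain ⟨n₂, hn₂⟩ := exists_nat_ge ((1 / c') ^ d)
  refine ⟨κ * c', mul_pos hκ0 hc'0, max n₁ n₂, fun n hn => ?_⟩
  set ν := (n : ℝ) ^ (1 / (d : ℝ)) with hν
  have hν0 : 0 ≤ ν := by positivity
  have hνd : ν ^ d = n := by
    rw [hν, one_div]
    exact Real.rpow_inv_natCast_pow (by positivity) hd0
  have hD1 : 1 ≤ c' * ν := by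
    have h1 : (1 / c') ^ d ≤ ν ^ d := by
      rw [hνd]
      refine hn₂.trans ?_
      exact_mod_cast (le_max_right _ _).trans hn
    have h2 := le_of_pow_le_pow_left₀ hd0 hν0 h1
    rwa [div_le_iff₀ hc'0, mul_comm] at h2
  set D := c' * ν with hDdef
  have hD0 : 0 < D := by linarith
  have hwD : κ * c' * ν = κ * D := by rw [hDdef]; ring
  rw [hwD]
  have hw : 0 < κ * D := mul_pos hκ0 hD0
  obtain ⟨S, hS, hsep, t, -, -, hM⟩ := (isGreatest_nearPairMax k d n (by omega) (κ * D)).1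
  refine hM.trans ?_
  by_contra! hlt
  have hconf : ∀ v ∈ S, (degIn (closeGraph d (2 * D)) S v : ℝ) ≤ δ * #S := by
    intro v _
    refine (degIn_closeGraph_le hsep (by linarith) v).trans ?_
    rw [hS]
    have h5 : 0 ≤ 5 * c' := by linarith
    have h6 : 5 * c' ≤ 1 := by
      have := min_le_right δ 1
      rw [hc']
      linarith
    calc (2 * (2 * D) + 1) ^ d ≤ (5 * D) ^ d := by gcongr; linarith
      _ = (5 * c') ^ d * n := by rw [hDdef, ← hνd]; ring
      _ ≤ (5 * c') * n := by
          gcongr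
          exact pow_le_of_le_one h5 h6 hd0
      _ ≤ δ * n := by
          gcongr
          have := min_le_left δ 1
          rw [hc']
          linarith
  have hedges : 2 * turanNumber #S (A k d) <
      dartCount (⨆ l, annulusGraph d (t l) (κ * D)) S := by
    rw [← two_mul_ncard_edgeSet_comap, ← nearGraph_eq_comap, hS]
    omega
  obtain ⟨B, hB, hX, hX'⟩ := hgraph (fun l => annulusGraph d (t l) (κ * D)) (closeGraph d (2 * D)) S
    (by rw [hS]; exact (le_max_left _ _).trans hn) hconf hedges
  obtain ⟨Q, hQ, hQ1, hQ2⟩ := exists_almostFlat_of_isBlowup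
    (P := fun Q => IsNearlyDistanceSet k ε Q ∧ IsAlmostFlat Q (d - 1) α)
    (fun B => hgeo B) hκ1 hm hw hD0 le_rfl hB hX hX'
  exact hno Q hQ hQ1 hQ2

end Main

end NearDist

theorem mainTheorem3 (d k : ℕ) (hd : 2 ≤ d) (hk : 1 ≤ k) :
    IsGreatest (NearDist.almostFlatCards k d (d - 1)) (NearDist.A k d) ∧
    (∃ n₀ : ℕ, ∀ n : ℕ, n₀ ≤ n →
      NearDist.nearPairMax k d n 1 ≤ NearDist.turanNumber n (NearDist.A k d) ∧
      (NearDist.turanNumber n (NearDist.A k d) : ℝ) ≤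
        (1 - 1 / (NearDist.A k d : ℝ)) * ((n : ℝ) ^ 2 / 2)) ∧
    (∃ c : ℝ, 0 < c ∧ ∃ n₀ : ℕ, ∀ n : ℕ, n₀ ≤ n →
      NearDist.nearPairMax k d n (c * (n : ℝ) ^ (1 / (d : ℝ))) ≤
        NearDist.turanNumber n (NearDist.A k d) ∧
      (NearDist.turanNumber n (NearDist.A k d) : ℝ) ≤
        (1 - 1 / (NearDist.A k d : ℝ)) * ((n : ℝ) ^ 2 / 2)) := by
  have hT := fun n => NearDist.turanNumber_le n (NearDist.one_le_A k d)
  obtain ⟨c, hc, n₀, h⟩ := NearDist.exists_nearPairMax_le_turanNumber hd hk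
  refine ⟨NearDist.isGreatest_A k d, ?_, c, hc, n₀, fun n hn => ⟨h n hn, hT n⟩⟩
  -- Width `1` is eventually below `c * n ^ (1 / d)`, so the first bound follows from the second by
  -- monotonicity in the width.
  have hlim : Filter.Tendsto (fun n : ℕ => c * (n : ℝ) ^ (1 / (d : ℝ))) Filter.atTop Filter.atTop :=
    ((tendsto_rpow_atTop (by positivity)).comp tendsto_natCast_atTop_atTop).const_mul_atTop hc
  obtain ⟨n₁, h₁⟩ := Filter.eventually_atTop.1 (hlim.eventually_ge_atTop 1)
  exact ⟨max n₀ n₁, fun n hn =>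
    ⟨(NearDist.nearPairMax_mono k (by omega) n (h₁ n ((le_max_right _ _).trans hn))).trans
      (h n ((le_max_left _ _).trans hn)), hT n⟩⟩
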